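/- Let $0<\alpha<1$, $T>0$, $x_l<x_r$ and $L=x_r-x_l$. For $0<\beta<1$ let ${}^C_0D_t^{\beta}g(t)=\frac1{\Gamma(1-\beta)}\int_0^t g'(\tau)(t-\tau)^{-\beta}\,d\tau$ be the Caputo derivative. Let $u\in C^{4,2}_{x,t}([x_l,x_r]\times[0,T])$, that is, $\partial_x^k u$ $(k\le 4)$ and $\partial_t^k u$ $(k\le 2)$ exist and are continuous on the closed rectangle, and suppose that $u$ solves $$ \begin{aligned} &{}^C_0D_t^\alpha u(x,t)=u_{xx}(x,t)+f(x,t), && x\in(x_l,x_r),\ 0<t\le T,\\ &u(x,0)=u_0(x), && x\in(x_l,x_r),\\ &u_x(x_l,t)={}^C_0D_t^{\alpha/2}u(x_l,t),\qquad u_x(x_r,t)=-{}^C_0D_t^{\alpha/2}u(x_r,t), && 0<t\le T, \end{aligned} $$ where $u_0$ and $f(\cdot,t)$, $0<t\le T$, are continuous on $[x_l,x_r]$. For positive integers $N_T,N_S$ put $\Delta t=T/N_T$, $t_n=n\Delta t$, $h=L/N_S$, $x_i=x_l+ih$. Let $\varepsilon_0>0$ and, for each order $\beta\in\{\alpha,\alpha/2\}$,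 let $w_j^{(\beta)},s_j^{(\beta)}>0$ $(1\le j\le N_\beta)$ satisfy $$\Big|t^{-\beta}-\sum_{j=1}^{N_\beta}w^{(\beta)}_je^{-s^{(\beta)}_jt}\Big|\le\varepsilon_0\qquad(\Delta t\le t\le T).$$ The FIDR approximation of order $\beta$ of the Caputo derivative of a mesh function $(g^n)_{0\le n\le N_T}$ is, for $1\le n\le N_T$, $$\mathbb D_t^\beta g^n=\frac{g^n-g^{n-1}}{\Delta t^\beta\,\Gamma(2-\beta)}+\frac1{\Gamma(1-\beta)}\sum_{j=1}^{N_\beta}w_j^{(\beta)}\Psi_j^n,\qquad \Psi_j^1=0,$$ $$\Psi_j^n=e^{-s_j\Delta t}\Psi_j^{n-1}+\frac{(g^{n-1}-g^{n-2})(1-e^{-s_j\Delta t})e^{-s_j\Delta t}}{s_j\Delta t}\quad(n\ge2),\qquad s_j=s_j^{(\beta)}.$$ Let $\{u_i^n\}_{0\le i\le N_S,\,0\le n\le N_T}$ solve the difference scheme $$ \begin{aligned} &\mathbb D_t^\alpha u_i^n=\delta_x^2u_i^n+f(x_i,t_n), && 1\le i\le N_S-1,\\ &\mathbb D_t^\alpha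 u_0^n=\tfrac2h\big[\delta_xu_{1/2}^n-\mathbb D_t^{\alpha/2}u_0^n\big]+f(x_0,t_n),\\ &\mathbb D_t^\alpha u_{N_S}^n=\tfrac2h\big[-\delta_xu_{N_S-1/2}^n-\mathbb D_t^{\alpha/2}u_{N_S}^n\big]+f(x_{N_S},t_n),\\ &u_i^0=u_0(x_i), && 0\le i\le N_S, \end{aligned} $$ the first three lines for $1\le n\le N_T$, where $\delta_xu_{i+1/2}=(u_{i+1}-u_i)/h$ and $\delta_x^2u_i=(\delta_xu_{i+1/2}-\delta_xu_{i-1/2})/h$. Put $e_i^k=u_i^k-u(x_i,t_k)$, $\|e^k\|_\infty=\max_{0\le i\le N_S}|e_i^k|$ and $$\tilde\mu=\frac{t_n^{-\alpha}-\varepsilon_0}{\Gamma(1-\alpha)},\qquad \tilde\nu=\frac{t_n^{-\alpha/2}-\varepsilon_0}{\Gamma(1-\alpha/2)}.$$ Then there is a constant $\tilde c_1>0$, depending only on $\alpha,T,x_l,x_r$ and $u$ (and not on $N_T,N_S,\varepsilon_0$, the weights and nodes, or $n$), such that for all such discretizations and every $1\le n\le N_T$ with $\tilde\mu>0$ and $\tilde\nu>0$,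 $$\sqrt{\Delta t\sum_{k=1}^n\|e^k\|_\infty^2}\ \le\ \tilde c_2\,\big(\Delta t^{2-\alpha}+h^2+\varepsilon_0\big),\qquad \tilde c_2>0,\quad \tilde c_2^2=\frac{4\tilde c_1^2T\big(1+\sqrt{1+L^2\tilde\mu}\big)}{L\tilde\mu}\Big(\frac1{\tilde\nu}+\frac L{\tilde\mu}\Big).$$ -/

import Mathlib

namespace FIDR

noncomputable section

/-! ### The continuous problem -/

/-- The Caputo derivative of order `α ∈ (0,1)`:
`(1 / Γ(1-α)) ∫₀ᵗ g'(τ) (t-τ)^{-α} dτ`. -/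
def caputo (α : ℝ) (g : ℝ → ℝ) (t : ℝ) : ℝ :=
  1 / Real.Gamma (1 - α) * ∫ τ in (0 : ℝ)..t, deriv g τ * (t - τ) ^ (-α)

/-- The class `C^{4,2}_{x,t}([xl,xr] × [0,T])`: the pure derivatives `∂ₓᵏ u` (`k ≤ 4`) and
`∂ₜᵏ u` (`k ≤ 2`) exist (one-sided at the boundary) and are jointly continuous on the closed
rectangle. -/
structure IsC42 (xl xr T : ℝ) (u : ℝ → ℝ → ℝ) : Prop where
  contDiffOn_x : ∀ t ∈ Set.Icc 0 T, ContDiffOn ℝ 4 (fun x => u x t) (Set.Icc xl xr)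
  contDiffOn_t : ∀ x ∈ Set.Icc xl xr, ContDiffOn ℝ 2 (fun t => u x t) (Set.Icc 0 T)
  continuousOn_x : ∀ k : ℕ, k ≤ 4 → ContinuousOn
    (fun p : ℝ × ℝ => iteratedDerivWithin k (fun x => u x p.2) (Set.Icc xl xr) p.1)
    (Set.Icc xl xr ×ˢ Set.Icc 0 T)
  continuousOn_t : ∀ k : ℕ, k ≤ 2 → ContinuousOn
    (fun p : ℝ × ℝ => iteratedDerivWithin k (fun t => u p.1 t) (Set.Icc 0 T) p.2)
    (Set.Icc xl xr ×ˢ Set.Icc 0 T)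

/-- `u` solves the linear time-fractional diffusion equation with source `f`, initial value `u₀`
and nonreflecting Caputo boundary conditions of order `α/2`. -/
structure IsSolution (α xl xr T : ℝ) (f : ℝ → ℝ → ℝ) (u₀ : ℝ → ℝ) (u : ℝ → ℝ → ℝ) : Prop where
  pde : ∀ x ∈ Set.Ioo xl xr, ∀ t ∈ Set.Ioc 0 T,
    caputo α (fun τ => u x τ) t
      = iteratedDerivWithin 2 (fun y => u y t) (Set.Icc xl xr) x + f x t
  init : ∀ x ∈ Set.Ioo xl xr, u x 0 = u₀ x
  left : ∀ t ∈ Set.Ioc 0 T,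
    derivWithin (fun y => u y t) (Set.Icc xl xr) xl = caputo (α / 2) (fun τ => u xl τ) t
  right : ∀ t ∈ Set.Ioc 0 T,
    derivWithin (fun y => u y t) (Set.Icc xl xr) xr = -caputo (α / 2) (fun τ => u xr τ) t

/-! ### The FIDR approximation of the Caputo derivative -/

/-- Positive weights `w` and nodes `s` whose sum of exponentials approximates `t^{-α}` on `[δ,T]`
with absolute error at most `ε`. -/
structure IsSumOfExp (α δ T ε : ℝ) {N : ℕ} (w s : Fin N → ℝ) : Prop where
  weight_pos : ∀ i, 0 < w i
  node_pos : ∀ i, 0 < s i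
  error_le : ∀ t ∈ Set.Icc δ T, |1 / t ^ α - ∑ i, w i * Real.exp (-(s i * t))| ≤ ε

/-- The history mode `Ψⁿ` with node `s`, for the mesh function `g`. The mode at step `1` is `0`
because the history interval `[0, t₀]` is a point; the value at index `0` is never used. -/
def mode (dt s : ℝ) (g : ℕ → ℝ) : ℕ → ℝ
  | 0 => 0
  | 1 => 0
  | n + 2 => Real.exp (-(s * dt)) * mode dt s g (n + 1)
      + (g (n + 1) - g n) * (1 - Real.exp (-(s * dt))) * Real.exp (-(s * dt)) / (s * dt)

/-- The FIDR approximation `𝔻ₜ^α gⁿ` (for `n ≥ 1`): L1 formula on the last time step plus the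
sum-of-exponentials history. -/
def fidr (α dt : ℝ) {N : ℕ} (w s : Fin N → ℝ) (g : ℕ → ℝ) (n : ℕ) : ℝ :=
  (g n - g (n - 1)) / (dt ^ α * Real.Gamma (2 - α))
    + 1 / Real.Gamma (1 - α) * ∑ i, w i * mode dt (s i) g n

/-! ### The finite difference scheme -/

/-- The difference quotient `δₓ g_{i+1/2}`. -/
def dx (h : ℝ) (g : ℕ → ℝ) (i : ℕ) : ℝ := (g (i + 1) - g i) / h

/-- The second difference quotient `δₓ² g_i` (for `i ≥ 1`). -/
def dxx (h : ℝ) (g : ℕ → ℝ) (i : ℕ) : ℝ := (dx h g i - dx h g (i - 1)) / h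

/-- `U i n` solves the finite difference scheme with `NS` cells of size `h` and `NT` time steps
of size `dt`; `w, s` are the weights and nodes for the order `α`, and `w', s'` those for the
order `α/2`. -/
structure IsSchemeSolution (α xl h dt : ℝ) (NS NT : ℕ) (f : ℝ → ℝ → ℝ) (u₀ : ℝ → ℝ)
    {N N' : ℕ} (w s : Fin N → ℝ) (w' s' : Fin N' → ℝ) (U : ℕ → ℕ → ℝ) : Prop where
  interior : ∀ n, 1 ≤ n → n ≤ NT → ∀ i, 1 ≤ i → i < NS →
    fidr α dt w s (U i) n = dxx h (fun j => U j n) i + f (xl + i * h) (n * dt)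
  left : ∀ n, 1 ≤ n → n ≤ NT →
    fidr α dt w s (U 0) n
      = 2 / h * (dx h (fun j => U j n) 0 - fidr (α / 2) dt w' s' (U 0) n) + f xl (n * dt)
  right : ∀ n, 1 ≤ n → n ≤ NT →
    fidr α dt w s (U NS) n
      = 2 / h * (-dx h (fun j => U j n) (NS - 1) - fidr (α / 2) dt w' s' (U NS) n)
        + f (xl + NS * h) (n * dt)
  init : ∀ i, i ≤ NS → U i 0 = u₀ (xl + i * h)

/-- The maximum over the spatial mesh of the error at time step `k`:
`‖eᵏ‖_∞ = max_{0 ≤ i ≤ NS} |U_iᵏ - u(x_i, t_k)|`. -/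
def errorNorm (xl h dt : ℝ) (NS : ℕ) (u : ℝ → ℝ → ℝ) (U : ℕ → ℕ → ℝ) (k : ℕ) : ℝ :=
  ‖fun i : Fin (NS + 1) => U i k - u (xl + (i : ℕ) * h) (k * dt)‖

/-- `(t^{-α} - ε) / Γ(1-α)`; this is `μ̃` for the order `α` and `ν̃` for the order `α/2`. -/
def coercivity (α ε t : ℝ) : ℝ := (t ^ (-α) - ε) / Real.Gamma (1 - α)

/-- The constant `c̃₂` given by
`c̃₂² = 4 c̃₁² T (1 + √(1 + L² μ̃)) / (L μ̃) · (1/ν̃ + L/μ̃)`. -/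
def errorConst (c₁ T L μ ν : ℝ) : ℝ :=
  √(4 * c₁ ^ 2 * T * (1 + √(1 + L ^ 2 * μ)) / (L * μ) * (1 / ν + L / μ))

end

end FIDR

namespace FIDR

theorem mode_sub (dt s : ℝ) (g g' : ℕ → ℝ) (n : ℕ) :
    mode dt s (fun k => g k - g' k) n = mode dt s g n - mode dt s g' n := by
  induction n with
  | zero => simp [mode]
  | succ n ih =>
    cases n with
    | zero => simp [mode]
    | succ n => simp only [mode, ih]; ring

theorem fidr_sub (α dt : ℝ) {N : ℕ} (w s : Fin N → ℝ) (g g' : ℕ → ℝ) (n : ℕ) :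
    fidr α dt w s (fun k => g k - g' k) n = fidr α dt w s g n - fidr α dt w s g' n := by
  simp only [fidr, mode_sub, mul_sub, Finset.sum_sub_distrib]
  ring

theorem mode_succ_eq_sum (dt s : ℝ) (g : ℕ → ℝ) (m : ℕ) :
    mode dt s g (m + 1) = (1 - Real.exp (-(s * dt))) / (s * dt) *
      ∑ l ∈ Finset.range m, Real.exp (-(s * dt)) ^ (m - l) * (g (l + 1) - g l) := by
  induction m with
  | zero => simp [mode]
  | succ m ih =>
    have h : ∑ l ∈ Finset.range m, Real.exp (-(s * dt)) ^ (m + 1 - l) * (g (l + 1) - g l)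
        = Real.exp (-(s * dt)) *
          ∑ l ∈ Finset.range m, Real.exp (-(s * dt)) ^ (m - l) * (g (l + 1) - g l) := by
      rw [Finset.mul_sum]
      refine Finset.sum_congr rfl fun l hl => ?_
      rw [Nat.sub_add_comm (Finset.mem_range.1 hl).le, pow_succ]
      ring
    rw [mode, ih, Finset.sum_range_succ, h]
    simp only [Nat.add_sub_cancel_left, pow_one]
    ring

/-- The convolution weights of the FIDR operator. -/
noncomputable def kernelWeight (α dt : ℝ) {N : ℕ} (w s : Fin N → ℝ) (j : ℕ) : ℝ :=
  if j = 0 then 1 / (dt ^ α * Real.Gamma (2 - α))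
  else 1 / Real.Gamma (1 - α) *
    ∑ i, w i * ((1 - Real.exp (-(s i * dt))) / (s i * dt) * Real.exp (-(s i * dt)) ^ j)

theorem fidr_succ_eq_sum (α dt : ℝ) {N : ℕ} (w s : Fin N → ℝ) (g : ℕ → ℝ) (m : ℕ) :
    fidr α dt w s g (m + 1) =
      ∑ l ∈ Finset.range (m + 1), kernelWeight α dt w s (m - l) * (g (l + 1) - g l) := by
  have h : ∀ l ∈ Finset.range m, kernelWeight α dt w s (m - l) * (g (l + 1) - g l) =
      1 / Real.Gamma (1 - α) * ∑ i, w i * ((1 - Real.exp (-(s i * dt))) / (s i * dt) *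
        (Real.exp (-(s i * dt)) ^ (m - l) * (g (l + 1) - g l))) := by
    intro l hl
    have : m - l ≠ 0 := by have := Finset.mem_range.1 hl; omega
    rw [kernelWeight, if_neg this, mul_assoc, Finset.sum_mul]
    congr 1
    exact Finset.sum_congr rfl fun i _ => by ring
  rw [Finset.sum_range_succ, Finset.sum_congr rfl h, ← Finset.mul_sum, Finset.sum_comm]
  simp only [fidr, mode_succ_eq_sum, ← Finset.mul_sum, Nat.sub_self, kernelWeight, if_true,
    Nat.add_sub_cancel]
  ring

theorem sum_monotone_mul_sub_ge {a p : ℕ → ℝ} (k : ℕ) (ha : ∀ l < k, a l ≤ a (l + 1))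
    (ha₀ : 0 ≤ a 0) (hp : ∀ l, 0 ≤ p l) :
    -(a k * p (k + 1)) ≤ ∑ l ∈ Finset.range (k + 1), a l * (p l - p (l + 1)) := by
  induction k with
  | zero => simp; nlinarith [mul_nonneg ha₀ (hp 0)]
  | succ k ih =>
    rw [Finset.sum_range_succ]
    have := ih fun l hl => ha l (by omega)
    have := mul_le_mul_of_nonneg_right (ha k (by omega)) (hp (k + 1))
    linarith

theorem mul_convolution_sub_ge {b : ℕ → ℝ} (hb : Antitone b) (hb₀ : ∀ j, 0 ≤ b j)
    (g : ℕ → ℝ) (m : ℕ) :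
    1 / 2 * ∑ l ∈ Finset.range (m + 1), b (m - l) * (g (l + 1) ^ 2 - g l ^ 2) ≤
      g (m + 1) * ∑ l ∈ Finset.range (m + 1), b (m - l) * (g (l + 1) - g l) := by
  have key := sum_monotone_mul_sub_ge (a := fun l => b (m - l))
    (p := fun l => (g (m + 1) - g l) ^ 2) m (fun l _ => hb (by omega)) (hb₀ _)
    (fun l => sq_nonneg _)
  have : ∑ l ∈ Finset.range (m + 1),
        b (m - l) * ((g (m + 1) - g l) ^ 2 - (g (m + 1) - g (l + 1)) ^ 2) =
      2 * (g (m + 1) * ∑ l ∈ Finset.range (m + 1), b (m - l) * (g (l + 1) - g l)) -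
        ∑ l ∈ Finset.range (m + 1), b (m - l) * (g (l + 1) ^ 2 - g l ^ 2) := by
    rw [Finset.mul_sum, Finset.mul_sum, ← Finset.sum_sub_distrib]
    exact Finset.sum_congr rfl fun i _ => by ring
  rw [this] at key
  simp at key
  linarith

theorem sum_convolution_sub (b g : ℕ → ℝ) (hg : g 0 = 0) (n : ℕ) :
    ∑ m ∈ Finset.range n, ∑ l ∈ Finset.range (m + 1), b (m - l) * (g (l + 1) - g l) =
      ∑ m ∈ Finset.range n, b (n - 1 - m) * g (m + 1) := by
  have h : ∀ m, ∑ l ∈ Finset.range (m + 1), b (m - l) * (g (l + 1) - g l) =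
      ∑ l ∈ Finset.range (m + 1), b (m - l) * g (l + 1) -
        ∑ l ∈ Finset.range m, b (m - 1 - l) * g (l + 1) := by
    intro m
    simp only [mul_sub, Finset.sum_sub_distrib]
    congr 1
    rw [Finset.sum_range_succ', hg]
    simp only [mul_zero, add_zero]
    exact Finset.sum_congr rfl fun l _ => by rw [Nat.sub_add_eq, Nat.sub_right_comm]
  induction n with
  | zero => simp
  | succ n ih => rw [Finset.sum_range_succ, ih, h]; simp

theorem convolution_form_ge_of_antitone {b : ℕ → ℝ} (hb : Antitone b) (hb₀ : ∀ j, 0 ≤ b j)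
    (g : ℕ → ℝ) (hg : g 0 = 0) (n : ℕ) :
    1 / 2 * b (n - 1) * ∑ m ∈ Finset.range n, g (m + 1) ^ 2 ≤
      ∑ m ∈ Finset.range n,
        g (m + 1) * ∑ l ∈ Finset.range (m + 1), b (m - l) * (g (l + 1) - g l) := by
  calc _ ≤ 1 / 2 * ∑ m ∈ Finset.range n, b (n - 1 - m) * g (m + 1) ^ 2 := by
        rw [mul_assoc, Finset.mul_sum]
        gcongr
        exact hb (by omega)
    _ = ∑ m ∈ Finset.range n,
          1 / 2 * ∑ l ∈ Finset.range (m + 1), b (m - l) * (g (l + 1) ^ 2 - g l ^ 2) := by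
        rw [← Finset.mul_sum, sum_convolution_sub b (fun k => g k ^ 2) (by simp [hg])]
    _ ≤ _ := Finset.sum_le_sum fun m _ => mul_convolution_sub_ge hb hb₀ g m

theorem mode_form_ge {q : ℝ} (hq₀ : 0 < q) (hq₁ : q < 1) {g Φ : ℕ → ℝ} (hg : g 0 = 0)
    (hΦ₀ : Φ 0 = 0) (hΦ : ∀ m, Φ (m + 1) = q * Φ m + (g (m + 1) - g m)) (n : ℕ) :
    (g n - Φ n) ^ 2 / (2 * (1 - q)) ≤ ∑ m ∈ Finset.range n, g (m + 1) * Φ m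
      + 1 / (2 * (1 + q)) * ∑ m ∈ Finset.range n, (g (m + 1) - g m) ^ 2 := by
  induction n with
  | zero => simp [hg, hΦ₀]
  | succ n ih =>
    rw [Finset.sum_range_succ, Finset.sum_range_succ, hΦ]
    have h1 : (1 - q) ≠ 0 := by linarith
    have h2 : (1 + q) ≠ 0 := by linarith
    have key : g (n + 1) * Φ n + 1 / (2 * (1 + q)) * (g (n + 1) - g n) ^ 2
        + (g n - Φ n) ^ 2 / (2 * (1 - q))
        - (g (n + 1) - (q * Φ n + (g (n + 1) - g n))) ^ 2 / (2 * (1 - q))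
        = (q * Φ n + (g (n + 1) - g n) + Φ n) ^ 2 / (2 * (1 + q)) := by
      field_simp
      ring
    have : 0 ≤ (q * Φ n + (g (n + 1) - g n) + Φ n) ^ 2 / (2 * (1 + q)) := by positivity
    linarith

theorem two_mul_one_sub_exp_le {x : ℝ} (hx : 0 ≤ x) :
    2 * (1 - Real.exp (-x)) ≤ x * (1 + Real.exp (-x)) := by
  have hd : ∀ y : ℝ, HasDerivAt (fun y => y * (1 + Real.exp (-y)) - 2 * (1 - Real.exp (-y)))
      (1 - Real.exp (-y) * (1 + y)) y := by
    intro y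
    have he : HasDerivAt (fun y : ℝ => Real.exp (-y)) (-Real.exp (-y)) y := by
      simpa using (hasDerivAt_neg y).exp
    exact (((hasDerivAt_id' y).fun_mul (he.const_add 1)).fun_sub
      ((he.const_sub 1).const_mul 2)).congr_deriv (by ring)
  have hm : Monotone fun y : ℝ => y * (1 + Real.exp (-y)) - 2 * (1 - Real.exp (-y)) := by
    refine monotone_of_hasDerivAt_nonneg hd fun y => ?_
    have h1 := Real.add_one_le_exp y
    have h2 := Real.exp_pos (-y)
    have h3 : Real.exp (-y) * Real.exp y = 1 := by rw [← Real.exp_add]; simp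
    simp only [Pi.zero_apply]
    nlinarith
  have := hm hx
  simp at this
  linarith

theorem one_sub_exp_div_le_one {x : ℝ} (hx : 0 < x) : (1 - Real.exp (-x)) / x ≤ 1 := by
  rw [div_le_one hx]
  linarith [Real.add_one_le_exp (-x)]

theorem exp_le_one_sub_exp_div {x : ℝ} (hx : 0 < x) :
    Real.exp (-x) ≤ (1 - Real.exp (-x)) / x := by
  rw [le_div_iff₀ hx]
  have h1 := Real.add_one_le_exp x
  have h2 := Real.exp_pos (-x)
  have h3 : Real.exp (-x) * Real.exp x = 1 := by rw [← Real.exp_add]; simp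
  nlinarith

theorem sum_sq_le_sq_mul_sum_sq_sub (g : ℕ → ℝ) (hg : g 0 = 0) (n : ℕ) :
    ∑ m ∈ Finset.range n, g (m + 1) ^ 2 ≤
      (n : ℝ) ^ 2 * ∑ m ∈ Finset.range n, (g (m + 1) - g m) ^ 2 := by
  have h : ∀ m ∈ Finset.range n,
      g (m + 1) ^ 2 ≤ n * ∑ m ∈ Finset.range n, (g (m + 1) - g m) ^ 2 := by
    intro m hm
    have hm := Finset.mem_range.1 hm
    have h1 : g (m + 1) = ∑ l ∈ Finset.range (m + 1), (g (l + 1) - g l) := by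
      rw [Finset.sum_range_sub, hg, sub_zero]
    calc g (m + 1) ^ 2 ≤ (Finset.range (m + 1)).card *
          ∑ l ∈ Finset.range (m + 1), (g (l + 1) - g l) ^ 2 := by
          rw [h1]; exact sq_sum_le_card_mul_sum_sq
      _ ≤ _ := by
          rw [Finset.card_range]
          refine mul_le_mul (by exact_mod_cast hm) ?_ (by positivity) (by positivity)
          exact Finset.sum_le_sum_of_subset_of_nonneg
            (Finset.range_subset_range.2 hm) fun _ _ _ => sq_nonneg _
  calc _ ≤ _ := Finset.sum_le_sum h
    _ = _ := by rw [Finset.sum_const, Finset.card_range, nsmul_eq_mul]; ring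

theorem Gamma_two_sub {β : ℝ} (hβ : β < 1) :
    Real.Gamma (2 - β) = (1 - β) * Real.Gamma (1 - β) := by
  rw [← Real.Gamma_add_one (by linarith)]
  congr 1
  ring

section Coercivity

variable {β dt T ε : ℝ} {N : ℕ} {w s : Fin N → ℝ}

theorem rpow_neg_sub_le_sum_exp (hdt : 0 < dt) (hw : IsSumOfExp β dt T ε w s) {n : ℕ}
    (hn : 1 ≤ n) (hnT : n * dt ≤ T) :
    (n * dt) ^ (-β) - ε ≤ ∑ i, w i * Real.exp (-(s i * dt)) ^ n ∧
      ∑ i, w i * Real.exp (-(s i * dt)) ^ n ≤ (n * dt) ^ (-β) + ε := by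
  have hn' : (1 : ℝ) ≤ n := by exact_mod_cast hn
  have h := hw.error_le (n * dt) ⟨by nlinarith, hnT⟩
  have he : ∀ i, Real.exp (-(s i * (n * dt))) = Real.exp (-(s i * dt)) ^ n := by
    intro i
    rw [← Real.exp_nat_mul]
    congr 1
    ring
  simp only [he, one_div] at h
  rw [← Real.rpow_neg (by positivity), abs_le] at h
  constructor <;> linarith

theorem kernelWeight_antitone (hβ₁ : β < 1) (hdt : 0 < dt) (hdT : dt ≤ T)
    (hw : IsSumOfExp β dt T ε w s) (hε : dt ^ (-β) + ε ≤ dt ^ (-β) / (1 - β)) :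
    Antitone (kernelWeight β dt w s) := by
  have hG : 0 < Real.Gamma (1 - β) := Real.Gamma_pos_of_pos (by linarith)
  have hβ' : 0 < 1 - β := by linarith
  refine antitone_nat_of_succ_le fun j => ?_
  have hx : ∀ i, 0 < s i * dt := fun i => mul_pos (hw.node_pos i) hdt
  rw [kernelWeight, if_neg (by omega), kernelWeight]
  split_ifs with hj
  · subst hj
    have h1 := (rpow_neg_sub_le_sum_exp hdt hw le_rfl (by simpa using hdT)).2
    simp only [Nat.cast_one, one_mul] at h1
    have h2 : ∑ i, w i * ((1 - Real.exp (-(s i * dt))) / (s i * dt)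
        * Real.exp (-(s i * dt)) ^ (0 + 1)) ≤ ∑ i, w i * Real.exp (-(s i * dt)) ^ 1 := by
      refine Finset.sum_le_sum fun i _ => mul_le_mul_of_nonneg_left ?_ (hw.weight_pos i).le
      rw [zero_add]
      exact mul_le_of_le_one_left (by positivity) (one_sub_exp_div_le_one (hx i))
    have h3 : 1 / (dt ^ β * Real.Gamma (2 - β)) =
        1 / Real.Gamma (1 - β) * (dt ^ (-β) / (1 - β)) := by
      rw [Gamma_two_sub hβ₁, Real.rpow_neg hdt.le]
      field_simp
    rw [h3]
    gcongr
    linarith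
  · refine mul_le_mul_of_nonneg_left (Finset.sum_le_sum fun i _ => mul_le_mul_of_nonneg_left
      (mul_le_mul_of_nonneg_left ?_ ?_) (hw.weight_pos i).le) (by positivity)
    · exact pow_le_pow_of_le_one (Real.exp_pos _).le
        (Real.exp_le_one_iff.2 (by linarith [hx i])) (Nat.le_succ j)
    · exact (Real.exp_pos _).le.trans (exp_le_one_sub_exp_div (hx i))

theorem kernelWeight_nonneg (hβ₁ : β < 1) (hdt : 0 < dt) (hw : IsSumOfExp β dt T ε w s) (j : ℕ) :
    0 ≤ kernelWeight β dt w s j := by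
  have hG : 0 < Real.Gamma (1 - β) := Real.Gamma_pos_of_pos (by linarith)
  have hG' : 0 < Real.Gamma (2 - β) := Real.Gamma_pos_of_pos (by linarith)
  rw [kernelWeight]
  split_ifs
  · positivity
  · refine mul_nonneg (by positivity) (Finset.sum_nonneg fun i _ => ?_)
    have := (Real.exp_pos _).le.trans (exp_le_one_sub_exp_div (mul_pos (hw.node_pos i) hdt))
    have := (hw.weight_pos i).le
    positivity

theorem coercivity_le_kernelWeight (hβ₀ : 0 < β) (hβ₁ : β < 1) (hdt : 0 < dt)
    (hε : 0 ≤ ε) (hw : IsSumOfExp β dt T ε w s) {n : ℕ} (hn : 1 ≤ n) (hnT : n * dt ≤ T) :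
    coercivity β ε (n * dt) ≤ kernelWeight β dt w s (n - 1) := by
  have hG : 0 < Real.Gamma (1 - β) := Real.Gamma_pos_of_pos (by linarith)
  have hβ' : 0 < 1 - β := by linarith
  rw [coercivity, kernelWeight, div_eq_inv_mul, ← one_div]
  split_ifs with h
  · have : n = 1 := by omega
    subst this
    rw [Gamma_two_sub hβ₁, Nat.cast_one, one_mul]
    have h3 : 1 / (dt ^ β * ((1 - β) * Real.Gamma (1 - β))) =
        1 / Real.Gamma (1 - β) * (dt ^ (-β) / (1 - β)) := by
      rw [Real.rpow_neg hdt.le]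
      field_simp
    rw [h3]
    gcongr
    have : dt ^ (-β) ≤ dt ^ (-β) / (1 - β) :=
      le_div_self (by positivity) hβ' (by linarith)
    linarith
  · gcongr
    refine (rpow_neg_sub_le_sum_exp hdt hw hn hnT).1.trans (Finset.sum_le_sum fun i _ => ?_)
    refine mul_le_mul_of_nonneg_left ?_ (hw.weight_pos i).le
    obtain ⟨m, rfl⟩ : ∃ m, n = m + 1 := ⟨n - 1, by omega⟩
    rw [Nat.add_sub_cancel, pow_succ, mul_comm]
    gcongr
    exact exp_le_one_sub_exp_div (mul_pos (hw.node_pos i) hdt)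

theorem sum_mul_mode_ge (hdt : 0 < dt) {σ : ℝ} (hσ : 0 < σ) (g : ℕ → ℝ) (hg : g 0 = 0) (n : ℕ) :
    -(Real.exp (-(σ * dt)) / 4 * ∑ m ∈ Finset.range n, (g (m + 1) - g m) ^ 2) ≤
      ∑ m ∈ Finset.range n, g (m + 1) * mode dt σ g (m + 1) := by
  have hx : 0 < σ * dt := by positivity
  set x := σ * dt with hxdef
  set q := Real.exp (-x) with hq
  set κ := (1 - q) / x with hκ
  have hq₀ : 0 < q := Real.exp_pos _
  have hq₁ : q < 1 := Real.exp_lt_one_iff.2 (by linarith)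
  have hκ₀ : 0 < κ := div_pos (by linarith) hx
  have hκq : κ / (2 * (1 + q)) ≤ 1 / 4 := by
    rw [hκ, div_div, div_le_div_iff₀ (by positivity) (by norm_num)]
    linarith [two_mul_one_sub_exp_le hx.le]
  have hstep : ∀ m, mode dt σ g (m + 1) / (κ * q) * (κ * q) = mode dt σ g (m + 1) :=
    fun m => div_mul_cancel₀ _ (by positivity)
  have h := mode_form_ge hq₀ hq₁ (Φ := fun m => mode dt σ g (m + 1) / (κ * q)) hg
    (by simp [mode]) (fun m => by
      simp only [mode, ← hxdef, ← hq]
      rw [hκ]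
      have : 1 - q ≠ 0 := by linarith
      field_simp) n
  have h0 : 0 ≤ (g n - mode dt σ g (n + 1) / (κ * q)) ^ 2 / (2 * (1 - q)) :=
    div_nonneg (sq_nonneg _) (by linarith)
  have h1 := mul_nonneg (mul_pos hκ₀ hq₀).le (h0.trans h)
  rw [mul_add, Finset.mul_sum] at h1
  have h2 : ∀ m ∈ Finset.range n, κ * q * (g (m + 1) * (mode dt σ g (m + 1) / (κ * q))) =
      g (m + 1) * mode dt σ g (m + 1) := fun m _ => by
    rw [mul_left_comm, mul_comm (κ * q), hstep]
  rw [Finset.sum_congr rfl h2] at h1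
  have hS : 0 ≤ ∑ m ∈ Finset.range n, (g (m + 1) - g m) ^ 2 :=
    Finset.sum_nonneg fun _ _ => sq_nonneg _
  have h3 : κ * q * (1 / (2 * (1 + q)) * ∑ m ∈ Finset.range n, (g (m + 1) - g m) ^ 2) ≤
      q / 4 * ∑ m ∈ Finset.range n, (g (m + 1) - g m) ^ 2 := by
    rw [← mul_assoc]
    refine mul_le_mul_of_nonneg_right ?_ hS
    calc _ = q * (κ / (2 * (1 + q))) := by ring
      _ ≤ q * (1 / 4) := by gcongr
      _ = q / 4 := by ring
  linarith

theorem sum_mul_fidr_ge_sum_sq_sub (hβ₁ : β < 1) (hdt : 0 < dt) (hdT : dt ≤ T)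
    (hw : IsSumOfExp β dt T ε w s) (hε : ε ≤ dt ^ (-β)) (g : ℕ → ℝ) (hg : g 0 = 0) (n : ℕ) :
    β * dt ^ (-β) / (2 * Real.Gamma (1 - β)) * ∑ m ∈ Finset.range n, (g (m + 1) - g m) ^ 2 ≤
      ∑ m ∈ Finset.range n, g (m + 1) * fidr β dt w s g (m + 1) := by
  have hG : 0 < Real.Gamma (1 - β) := Real.Gamma_pos_of_pos (by linarith)
  have hβ' : 0 < 1 - β := by linarith
  set S := ∑ m ∈ Finset.range n, (g (m + 1) - g m) ^ 2 with hSdef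
  have hS : 0 ≤ S := Finset.sum_nonneg fun _ _ => sq_nonneg _
  have hlocal : 1 / 2 * S ≤ ∑ m ∈ Finset.range n, g (m + 1) * (g (m + 1) - g m) := by
    have : ∑ m ∈ Finset.range n, g (m + 1) * (g (m + 1) - g m) =
        1 / 2 * S + 1 / 2 * ∑ m ∈ Finset.range n, (g (m + 1) ^ 2 - g m ^ 2) := by
      rw [hSdef, Finset.mul_sum, Finset.mul_sum, ← Finset.sum_add_distrib]
      exact Finset.sum_congr rfl fun _ _ => by ring
    rw [this, Finset.sum_range_sub (fun m => g m ^ 2), hg]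
    nlinarith [sq_nonneg (g n)]
  have hsplit : ∑ m ∈ Finset.range n, g (m + 1) * fidr β dt w s g (m + 1) =
      dt ^ (-β) / ((1 - β) * Real.Gamma (1 - β)) *
        ∑ m ∈ Finset.range n, g (m + 1) * (g (m + 1) - g m) +
      1 / Real.Gamma (1 - β) *
        ∑ i, w i * ∑ m ∈ Finset.range n, g (m + 1) * mode dt (s i) g (m + 1) := by
    simp only [fidr, Gamma_two_sub hβ₁, Real.rpow_neg hdt.le, Nat.add_sub_cancel, mul_add,
      Finset.sum_add_distrib, Finset.mul_sum]
    congr 1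
    · exact Finset.sum_congr rfl fun _ _ => by field_simp
    · rw [Finset.sum_comm]
      exact Finset.sum_congr rfl fun _ _ => Finset.sum_congr rfl fun _ _ => by ring
  have hmodes : -(1 / 2 * dt ^ (-β) * S) ≤
      ∑ i, w i * ∑ m ∈ Finset.range n, g (m + 1) * mode dt (s i) g (m + 1) := by
    have h1 := (rpow_neg_sub_le_sum_exp hdt hw le_rfl (by simpa using hdT)).2
    simp only [Nat.cast_one, one_mul, pow_one] at h1
    calc -(1 / 2 * dt ^ (-β) * S) ≤ -((∑ i, w i * Real.exp (-(s i * dt))) / 4 * S) := by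
          apply neg_le_neg
          gcongr
          linarith
      _ = ∑ i, w i * -(Real.exp (-(s i * dt)) / 4 * S) := by
          rw [Finset.sum_div, Finset.sum_mul, ← Finset.sum_neg_distrib]
          exact Finset.sum_congr rfl fun _ _ => by ring
      _ ≤ _ := Finset.sum_le_sum fun i _ => mul_le_mul_of_nonneg_left
          (sum_mul_mode_ge hdt (hw.node_pos i) g hg n) (hw.weight_pos i).le
  rw [hsplit]
  have hD : 0 < dt ^ (-β) := by positivity
  have hfrac : 1 + β ≤ 1 / (1 - β) := by
    rw [le_div_iff₀ hβ']; nlinarith [sq_nonneg β]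
  calc _ = 1 / Real.Gamma (1 - β) *
        (dt ^ (-β) * (1 + β) * (1 / 2 * S) + -(1 / 2 * dt ^ (-β) * S)) := by
        field_simp; ring
    _ ≤ 1 / Real.Gamma (1 - β) * (dt ^ (-β) * (1 / (1 - β)) *
          (∑ m ∈ Finset.range n, g (m + 1) * (g (m + 1) - g m)) +
        ∑ i, w i * ∑ m ∈ Finset.range n, g (m + 1) * mode dt (s i) g (m + 1)) := by
        gcongr
    _ = _ := by field_simp

theorem exists_fidr_coercive (hβ₀ : 0 < β) (hβ₁ : β < 1) :
    ∃ c : ℝ, 0 < c ∧ c ≤ 1 ∧ ∀ (T dt ε : ℝ) (N : ℕ) (w s : Fin N → ℝ), 0 < dt → 0 ≤ ε →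
      IsSumOfExp β dt T ε w s → ∀ n : ℕ, 1 ≤ n → n * dt ≤ T → 0 < coercivity β ε (n * dt) →
      ∀ g : ℕ → ℝ, g 0 = 0 →
        c * coercivity β ε (n * dt) * ∑ m ∈ Finset.range n, g (m + 1) ^ 2 ≤
          ∑ m ∈ Finset.range n, g (m + 1) * fidr β dt w s g (m + 1) := by
  have hG : 0 < Real.Gamma (1 - β) := Real.Gamma_pos_of_pos (by linarith)
  have hβ' : 0 < 1 - β := by linarith
  set M : ℝ := ((1 - β) / β) ^ (1 / β) with hM
  have hM₀ : 0 < M := by positivity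
  refine ⟨min (1 / 2) (β / (2 * M ^ 2)), lt_min (by norm_num) (by positivity),
    (min_le_left _ _).trans (by norm_num), ?_⟩
  intro T dt ε N w s hdt hε hw n hn hnT hco g hg
  have hn' : (1 : ℝ) ≤ n := by exact_mod_cast hn
  have hdT : dt ≤ T := by nlinarith
  have hSg : 0 ≤ ∑ m ∈ Finset.range n, g (m + 1) ^ 2 := Finset.sum_nonneg fun _ _ => sq_nonneg _
  by_cases hgood : dt ^ (-β) + ε ≤ dt ^ (-β) / (1 - β)
  · simp only [fidr_succ_eq_sum]
    refine le_trans ?_ (convolution_form_ge_of_antitone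
      (kernelWeight_antitone hβ₁ hdt hdT hw hgood) (kernelWeight_nonneg hβ₁ hdt hw) g hg n)
    gcongr
    · exact min_le_left _ _
    · exact coercivity_le_kernelWeight hβ₀ hβ₁ hdt hε hw hn hnT
  · have hD : 0 < dt ^ (-β) := by positivity
    have hεn : ε < (n * dt) ^ (-β) := by
      rw [coercivity] at hco
      have := (div_pos_iff_of_pos_right hG).1 hco
      linarith
    have hmul : ((n : ℝ) * dt) ^ (-β) = (n : ℝ) ^ (-β) * dt ^ (-β) :=
      Real.mul_rpow (by positivity) hdt.le
    have hn1 : (n : ℝ) ^ (-β) ≤ 1 := Real.rpow_le_one_of_one_le_of_nonpos hn' (by linarith)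
    have hnle : ((n : ℝ) * dt) ^ (-β) ≤ dt ^ (-β) := by
      rw [hmul]; exact mul_le_of_le_one_left hD.le hn1
    have hnM : (n : ℝ) ≤ M := by
      have h1 : β / (1 - β) * dt ^ (-β) < (n : ℝ) ^ (-β) * dt ^ (-β) := by
        rw [← hmul]
        refine lt_trans ?_ hεn
        have : dt ^ (-β) / (1 - β) = dt ^ (-β) + β / (1 - β) * dt ^ (-β) := by
          field_simp; ring
        linarith
      have h2 : β / (1 - β) < (n : ℝ) ^ (-β) := lt_of_mul_lt_mul_right h1 hD.le
      have h3 : (n : ℝ) ^ β ≤ (1 - β) / β := by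
        rw [Real.rpow_neg (by positivity)] at h2
        have := inv_anti₀ (by positivity) h2.le
        rwa [inv_inv, inv_div] at this
      calc (n : ℝ) = ((n : ℝ) ^ β) ^ (1 / β) := by
            rw [← Real.rpow_mul (by positivity), mul_one_div_cancel hβ₀.ne', Real.rpow_one]
        _ ≤ M := Real.rpow_le_rpow (by positivity) h3 (by positivity)
    refine le_trans ?_ (sum_mul_fidr_ge_sum_sq_sub hβ₁ hdt hdT hw (hεn.le.trans hnle) g hg n)
    have hSd : 0 ≤ ∑ m ∈ Finset.range n, (g (m + 1) - g m) ^ 2 :=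
      Finset.sum_nonneg fun _ _ => sq_nonneg _
    have hcoer : coercivity β ε (n * dt) ≤ dt ^ (-β) / Real.Gamma (1 - β) := by
      rw [coercivity]; gcongr; linarith
    calc _ ≤ β / (2 * M ^ 2) * (dt ^ (-β) / Real.Gamma (1 - β)) *
          (M ^ 2 * ∑ m ∈ Finset.range n, (g (m + 1) - g m) ^ 2) := by
          gcongr
          · exact min_le_right _ _
          · refine (sum_sq_le_sq_mul_sum_sq_sub g hg n).trans ?_
            gcongr
      _ = _ := by field_simp

end Coercivity

section Truncation

open MeasureTheory

/-- `g` has on `[0, T]` the derivative `g'`, which is bounded by `M` and `M`-Lipschitz. -/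
structure HasLipschitzDeriv (T M : ℝ) (g g' : ℝ → ℝ) : Prop where
  hasDeriv : ∀ τ ∈ Set.Icc 0 T, HasDerivWithinAt g (g' τ) (Set.Icc 0 T) τ
  bound : ∀ τ ∈ Set.Icc 0 T, |g' τ| ≤ M
  lipschitz : ∀ τ ∈ Set.Icc 0 T, ∀ σ ∈ Set.Icc 0 T, |g' τ - g' σ| ≤ M * |τ - σ|

variable {T M : ℝ} {g g' : ℝ → ℝ}

theorem HasLipschitzDeriv.continuousOn_deriv (hg : HasLipschitzDeriv T M g g') (hM : 0 ≤ M) :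
    ContinuousOn g' (Set.Icc 0 T) := by
  refine LipschitzOnWith.continuousOn (K := M.toNNReal) (LipschitzOnWith.of_dist_le_mul ?_)
  intro x hx y hy
  rw [Real.dist_eq, Real.dist_eq, Real.coe_toNNReal _ hM]
  exact hg.lipschitz x hx y hy

theorem HasLipschitzDeriv.hasDerivAt (hg : HasLipschitzDeriv T M g g') {τ : ℝ}
    (hτ : τ ∈ Set.Ioo 0 T) : HasDerivAt g (g' τ) τ :=
  (hg.hasDeriv τ (Set.Ioo_subset_Icc_self hτ)).hasDerivAt (Icc_mem_nhds hτ.1 hτ.2)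

theorem HasLipschitzDeriv.continuousOn (hg : HasLipschitzDeriv T M g g') :
    ContinuousOn g (Set.Icc 0 T) := fun τ hτ => (hg.hasDeriv τ hτ).continuousWithinAt

theorem HasLipschitzDeriv.exists_slope (hg : HasLipschitzDeriv T M g g') {a b : ℝ} (ha : 0 ≤ a)
    (hab : a < b) (hb : b ≤ T) : ∃ ξ ∈ Set.Ioo a b, g' ξ = (g b - g a) / (b - a) :=
  exists_hasDerivAt_eq_slope g g' hab (hg.continuousOn.mono (Set.Icc_subset_Icc ha hb))
    fun _ hx => hg.hasDerivAt (Set.Ioo_subset_Ioo ha hb hx)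

theorem HasLipschitzDeriv.abs_slope_le (hg : HasLipschitzDeriv T M g g') {a b : ℝ} (ha : 0 ≤ a)
    (hab : a < b) (hb : b ≤ T) : |(g b - g a) / (b - a)| ≤ M := by
  obtain ⟨ξ, hξ, h⟩ := hg.exists_slope ha hab hb
  rw [← h]
  exact hg.bound ξ ⟨ha.trans hξ.1.le, hξ.2.le.trans hb⟩

theorem HasLipschitzDeriv.abs_deriv_sub_slope_le (hg : HasLipschitzDeriv T M g g') (hM : 0 ≤ M)
    {a b : ℝ} (ha : 0 ≤ a) (hab : a < b) (hb : b ≤ T) {τ : ℝ} (hτ : τ ∈ Set.Icc a b) :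
    |g' τ - (g b - g a) / (b - a)| ≤ M * (b - a) := by
  obtain ⟨ξ, hξ, h⟩ := hg.exists_slope ha hab hb
  rw [← h]
  refine (hg.lipschitz τ ⟨ha.trans hτ.1, hτ.2.trans hb⟩ ξ
    ⟨ha.trans hξ.1.le, hξ.2.le.trans hb⟩).trans (mul_le_mul_of_nonneg_left ?_ hM)
  rw [abs_le]
  constructor <;> linarith [hτ.1, hτ.2, hξ.1, hξ.2]

theorem HasLipschitzDeriv.integral_deriv_sub_slope (hg : HasLipschitzDeriv T M g g') (hM : 0 ≤ M)
    {a b : ℝ} (ha : 0 ≤ a) (hab : a < b) (hb : b ≤ T) :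
    ∫ τ in a..b, (g' τ - (g b - g a) / (b - a)) = 0 := by
  have hsub : Set.Icc a b ⊆ Set.Icc 0 T := Set.Icc_subset_Icc ha hb
  have hinter : IntervalIntegrable g' volume a b :=
    ((hg.continuousOn_deriv hM).mono (by rwa [Set.uIcc_of_le hab.le])).intervalIntegrable
  rw [intervalIntegral.integral_sub hinter (by simp), intervalIntegral.integral_const,
    intervalIntegral.integral_eq_sub_of_hasDerivAt_of_le hab.le (hg.continuousOn.mono hsub)
      (fun x hx => hg.hasDerivAt (Set.Ioo_subset_Ioo ha hb hx)) hinter, smul_eq_mul,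
    mul_div_cancel₀ _ (by linarith), sub_self]

theorem HasLipschitzDeriv.abs_integral_mul_le (hg : HasLipschitzDeriv T M g g') (hM : 0 ≤ M)
    {a b : ℝ} (ha : 0 ≤ a) (hab : a < b) (hb : b ≤ T) {k : ℝ → ℝ}
    (hk : ContinuousOn k (Set.Icc a b)) (hkm : MonotoneOn k (Set.Icc a b)) :
    |∫ τ in a..b, (g' τ - (g b - g a) / (b - a)) * k τ| ≤ M * (b - a) ^ 2 * (k b - k a) := by
  have hsub : Set.Icc a b ⊆ Set.Icc 0 T := Set.Icc_subset_Icc ha hb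
  have hc : ContinuousOn (fun τ => g' τ - (g b - g a) / (b - a)) (Set.uIcc a b) := by
    rw [Set.uIcc_of_le hab.le]
    exact ((hg.continuousOn_deriv hM).mono hsub).sub continuousOn_const
  have hk' : ContinuousOn k (Set.uIcc a b) := by rwa [Set.uIcc_of_le hab.le]
  have h0 : ∫ τ in a..b, (g' τ - (g b - g a) / (b - a)) * k τ =
      ∫ τ in a..b, (g' τ - (g b - g a) / (b - a)) * (k τ - k a) := by
    simp only [mul_sub]
    rw [intervalIntegral.integral_sub (hc.fun_mul hk').intervalIntegrable
      (hc.fun_mul continuousOn_const).intervalIntegrable, intervalIntegral.integral_mul_const,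
      hg.integral_deriv_sub_slope hM ha hab hb]
    simp
  rw [h0]
  have hle := intervalIntegral.norm_integral_le_of_norm_le_const (a := a) (b := b)
    (C := M * (b - a) * (k b - k a))
    (f := fun τ => (g' τ - (g b - g a) / (b - a)) * (k τ - k a)) (fun τ hτ => by
      rw [Set.uIoc_of_le hab.le] at hτ
      have hτ' : τ ∈ Set.Icc a b := Set.Ioc_subset_Icc_self hτ
      have h1 := hkm (Set.left_mem_Icc.2 hab.le) hτ' hτ'.1
      have h2 := hkm hτ' (Set.right_mem_Icc.2 hab.le) hτ'.2
      rw [Real.norm_eq_abs, abs_mul, abs_of_nonneg (sub_nonneg.2 h1)]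
      have := hg.abs_deriv_sub_slope_le hM ha hab hb hτ'
      have : 0 ≤ b - a := by linarith
      gcongr)
  rw [Real.norm_eq_abs, abs_of_pos (sub_pos.2 hab)] at hle
  exact hle.trans (le_of_eq (by ring))

theorem intervalIntegrable_sub_rpow {β : ℝ} (hβ : β < 1) (t a b : ℝ) :
    IntervalIntegrable (fun τ => (t - τ) ^ (-β)) volume a b := by
  have h : IntervalIntegrable (fun x : ℝ => x ^ (-β)) volume (t - a) (t - b) :=
    intervalIntegral.intervalIntegrable_rpow' (by linarith)
  simpa using h.comp_sub_left t

theorem integral_sub_rpow {β : ℝ} (hβ : β < 1) (t a : ℝ) :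
    ∫ τ in a..t, (t - τ) ^ (-β) = (t - a) ^ (1 - β) / (1 - β) := by
  rw [intervalIntegral.integral_comp_sub_left (fun x => x ^ (-β)) t, sub_self,
    integral_rpow (Or.inl (by linarith)), Real.zero_rpow (by linarith)]
  rw [neg_add_eq_sub, sub_zero]

theorem HasLipschitzDeriv.caputo_eq (hg : HasLipschitzDeriv T M g g') (β : ℝ) {t : ℝ}
    (ht₀ : 0 ≤ t) (ht : t ≤ T) :
    caputo β g t = 1 / Real.Gamma (1 - β) * ∫ τ in (0 : ℝ)..t, g' τ * (t - τ) ^ (-β) := by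
  rw [caputo]
  congr 1
  refine intervalIntegral.integral_congr_Ioo_of_le ht₀ fun τ hτ => ?_
  rw [(hg.hasDerivAt ⟨hτ.1, hτ.2.trans_le ht⟩).deriv]

theorem integral_exp_cell {σ dt : ℝ} (hσ : 0 < σ) (m l : ℕ) (hl : l ≤ m) :
    ∫ τ in (l * dt)..((l + 1 : ℕ) * dt), Real.exp (-(σ * ((m + 1 : ℕ) * dt - τ))) =
      (1 - Real.exp (-(σ * dt))) / σ * Real.exp (-(σ * dt)) ^ (m - l) := by
  have hd : ∀ τ : ℝ, HasDerivAt (fun τ => Real.exp (-(σ * ((m + 1 : ℕ) * dt - τ))) / σ)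
      (Real.exp (-(σ * ((m + 1 : ℕ) * dt - τ)))) τ := by
    intro τ
    have h := (((hasDerivAt_id' τ).const_sub ((m + 1 : ℕ) * dt)).const_mul σ).fun_neg.exp
    refine (h.div_const σ).congr_deriv ?_
    field_simp
  rw [intervalIntegral.integral_eq_sub_of_hasDerivAt (fun τ _ => hd τ)
    (Continuous.intervalIntegrable (by fun_prop) _ _)]
  obtain ⟨p, rfl⟩ := Nat.exists_eq_add_of_le hl
  have h1 : Real.exp (-(σ * (((l + p + 1 : ℕ) : ℝ) * dt - (l + 1 : ℕ) * dt)))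
      = Real.exp (-(σ * dt)) ^ p := by
    rw [← Real.exp_nat_mul]; congr 1; push_cast; ring
  have h2 : Real.exp (-(σ * (((l + p + 1 : ℕ) : ℝ) * dt - l * dt)))
      = Real.exp (-(σ * dt)) ^ p * Real.exp (-(σ * dt)) := by
    rw [← Real.exp_nat_mul, ← Real.exp_add]; congr 1; push_cast; ring
  rw [h1, h2, Nat.add_sub_cancel_left]
  ring

variable {β dt ε : ℝ} {N : ℕ} {w s : Fin N → ℝ}

theorem HasLipschitzDeriv.history_cell_error (hg : HasLipschitzDeriv T M g g') (hM : 0 ≤ M)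
    (hβ₀ : 0 < β) (hdt : 0 < dt) (hw : IsSumOfExp β dt T ε w s) {m l : ℕ} (hl : l < m)
    (hm : ((m + 1 : ℕ) : ℝ) * dt ≤ T) :
    |(∑ i, w i * ((1 - Real.exp (-(s i * dt))) / (s i * dt) * Real.exp (-(s i * dt)) ^ (m - l))) *
          (g ((l + 1 : ℕ) * dt) - g (l * dt)) -
        ∫ τ in (l * dt)..((l + 1 : ℕ) * dt), g' τ * ((m + 1 : ℕ) * dt - τ) ^ (-β)| ≤
      M * dt ^ 2 * ((((m + 1 : ℕ) : ℝ) * dt - (l + 1 : ℕ) * dt) ^ (-β) -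
        (((m + 1 : ℕ) : ℝ) * dt - l * dt) ^ (-β)) + M * ε * dt := by
  set t : ℝ := ((m + 1 : ℕ) : ℝ) * dt with ht
  set a : ℝ := l * dt with ha
  set b : ℝ := ((l + 1 : ℕ) : ℝ) * dt with hb
  have hba : b - a = dt := by rw [hb, ha]; push_cast; ring
  have ha₀ : 0 ≤ a := by positivity
  have hab : a < b := by linarith
  have hbt : b + dt ≤ t := by
    have : ((l + 1 : ℕ) : ℝ) ≤ m := by exact_mod_cast hl
    rw [hb, ht]; push_cast at *; nlinarith
  have hbT : b ≤ T := by linarith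
  have hpos : ∀ τ ∈ Set.Icc a b, 0 < t - τ := fun τ hτ => by linarith [hτ.2]
  have hkc : ContinuousOn (fun τ => (t - τ) ^ (-β)) (Set.Icc a b) :=
    ContinuousOn.rpow_const (by fun_prop) fun τ hτ => Or.inl (hpos τ hτ).ne'
  have hkm : MonotoneOn (fun τ => (t - τ) ^ (-β)) (Set.Icc a b) := fun x hx y hy hxy =>
    Real.rpow_le_rpow_of_nonpos (hpos y hy) (by linarith) (by linarith)
  have hgc : ContinuousOn g' (Set.Icc a b) :=
    (hg.continuousOn_deriv hM).mono (Set.Icc_subset_Icc ha₀ hbT)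
  have h1 := hg.abs_integral_mul_le hM ha₀ hab hbT hkc hkm
  set D := (g b - g a) / (b - a) with hD
  have hDM : |D| ≤ M := hg.abs_slope_le ha₀ hab hbT
  set S : ℝ → ℝ := fun τ => ∑ i, w i * Real.exp (-(s i * (t - τ))) with hS
  have hSc : ContinuousOn S (Set.Icc a b) := by rw [hS]; fun_prop
  have h2 : |∫ τ in a..b, ((t - τ) ^ (-β) - S τ)| ≤ ε * dt := by
    have := intervalIntegral.norm_integral_le_of_norm_le_const (a := a) (b := b) (C := ε)
      (f := fun τ => (t - τ) ^ (-β) - S τ) (fun τ hτ => by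
        rw [Set.uIoc_of_le hab.le] at hτ
        have hp := hpos τ (Set.Ioc_subset_Icc_self hτ)
        have := hw.error_le (t - τ) ⟨by linarith [hτ.2], by linarith [hτ.1]⟩
        rwa [one_div, ← Real.rpow_neg hp.le] at this)
    rwa [Real.norm_eq_abs, hba, abs_of_pos hdt] at this
  have hu : Set.uIcc a b = Set.Icc a b := Set.uIcc_of_le hab.le
  have hI : ∀ {F : ℝ → ℝ}, ContinuousOn F (Set.Icc a b) → IntervalIntegrable F volume a b :=
    fun hF => ContinuousOn.intervalIntegrable (by rwa [hu])
  have hSint : ∫ τ in a..b, S τ =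
      ∑ i, w i * ((1 - Real.exp (-(s i * dt))) / s i * Real.exp (-(s i * dt)) ^ (m - l)) := by
    rw [hS, intervalIntegral.integral_finsetSum
      fun i _ => Continuous.intervalIntegrable (by fun_prop) _ _]
    refine Finset.sum_congr rfl fun i _ => ?_
    rw [intervalIntegral.integral_const_mul, integral_exp_cell (hw.node_pos i) m l hl.le]
  have hleft : (∑ i, w i * ((1 - Real.exp (-(s i * dt))) / (s i * dt) *
      Real.exp (-(s i * dt)) ^ (m - l))) * (g b - g a) = D * ∫ τ in a..b, S τ := by
    rw [hSint, hD, hba, Finset.sum_mul, Finset.mul_sum]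
    refine Finset.sum_congr rfl fun i _ => ?_
    have := (hw.node_pos i).ne'
    field_simp
  have hsplit : ∫ τ in a..b, g' τ * (t - τ) ^ (-β) =
      (∫ τ in a..b, (g' τ - D) * (t - τ) ^ (-β)) + D * (∫ τ in a..b, ((t - τ) ^ (-β) - S τ))
        + D * ∫ τ in a..b, S τ := by
    rw [intervalIntegral.integral_sub (hI hkc) (hI hSc), ← intervalIntegral.integral_const_mul,
      mul_sub, ← intervalIntegral.integral_const_mul, ← intervalIntegral.integral_const_mul]
    rw [add_assoc, sub_add_cancel, ← intervalIntegral.integral_add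
      (hI ((hgc.fun_sub continuousOn_const).fun_mul hkc)) (hI (continuousOn_const.fun_mul hkc))]
    exact intervalIntegral.integral_congr fun τ _ => by ring
  rw [hleft, hsplit, hba] at *
  have h3 : |D * ∫ τ in a..b, ((t - τ) ^ (-β) - S τ)| ≤ M * (ε * dt) := by
    rw [abs_mul]; gcongr
  rw [abs_le] at h1 h3 ⊢
  constructor <;> linarith [h1.1, h1.2, h3.1, h3.2]

theorem HasLipschitzDeriv.last_cell_error (hg : HasLipschitzDeriv T M g g') (hM : 0 ≤ M)
    (hβ₁ : β < 1) (hdt : 0 < dt) {m : ℕ} (hm : ((m + 1 : ℕ) : ℝ) * dt ≤ T) :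
    |dt ^ (-β) / (1 - β) * (g ((m + 1 : ℕ) * dt) - g (m * dt)) -
        ∫ τ in (m * dt)..((m + 1 : ℕ) * dt), g' τ * ((m + 1 : ℕ) * dt - τ) ^ (-β)| ≤
      M * dt ^ (2 - β) / (1 - β) := by
  set t : ℝ := ((m + 1 : ℕ) : ℝ) * dt with ht
  set a : ℝ := m * dt with ha
  have hta : t - a = dt := by rw [ht, ha]; push_cast; ring
  have ha₀ : 0 ≤ a := by positivity
  have hat : a < t := by linarith
  set D := (g t - g a) / (t - a) with hD
  have hgc : ContinuousOn g' (Set.uIcc a t) := by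
    rw [Set.uIcc_of_le hat.le]
    exact (hg.continuousOn_deriv hM).mono (Set.Icc_subset_Icc ha₀ hm)
  have hki := intervalIntegrable_sub_rpow hβ₁ t a t
  have hk : ∫ τ in a..t, (t - τ) ^ (-β) = dt ^ (1 - β) / (1 - β) := by
    rw [integral_sub_rpow hβ₁, hta]
  have hleft : dt ^ (-β) / (1 - β) * (g t - g a) = D * ∫ τ in a..t, (t - τ) ^ (-β) := by
    rw [hk, hD, hta, sub_eq_add_neg 1 β, Real.rpow_add hdt, Real.rpow_one]
    field_simp
  rw [hleft, ← intervalIntegral.integral_const_mul,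
    ← intervalIntegral.integral_sub (hki.const_mul D) (hki.continuousOn_mul hgc)]
  have hle := intervalIntegral.norm_integral_le_of_norm_le (μ := volume) hat.le
    (f := fun τ => D * (t - τ) ^ (-β) - g' τ * (t - τ) ^ (-β))
    (g := fun τ => M * dt * (t - τ) ^ (-β))
    (Filter.Eventually.of_forall fun τ hτ => by
      have h1 := hg.abs_deriv_sub_slope_le hM ha₀ hat hm (Set.Ioc_subset_Icc_self hτ)
      rw [← sub_mul, Real.norm_eq_abs, abs_mul,
        abs_of_nonneg (Real.rpow_nonneg (by linarith [hτ.2]) _), abs_sub_comm]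
      rw [hta] at h1
      exact mul_le_mul_of_nonneg_right (by rwa [hD, hta])
        (Real.rpow_nonneg (by linarith [hτ.2]) _)) (hki.const_mul _)
  refine hle.trans (le_of_eq ?_)
  rw [intervalIntegral.integral_const_mul, hk, show (2 - β) = 1 + (1 - β) by ring,
    Real.rpow_add hdt, Real.rpow_one]
  ring

/-- The truncation error of the FIDR operator. -/
theorem HasLipschitzDeriv.abs_fidr_sub_caputo_le (hg : HasLipschitzDeriv T M g g') (hM : 0 ≤ M)
    (hβ₀ : 0 < β) (hβ₁ : β < 1) (hdt : 0 < dt) (hε : 0 ≤ ε) (hw : IsSumOfExp β dt T ε w s)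
    {n : ℕ} (hn : 1 ≤ n) (hnT : n * dt ≤ T) :
    |fidr β dt w s (fun k => g (k * dt)) n - caputo β g (n * dt)| ≤
      M * (1 + 1 / (1 - β) + T) / Real.Gamma (1 - β) * (dt ^ (2 - β) + ε) := by
  obtain ⟨m, rfl⟩ : ∃ m, n = m + 1 := ⟨n - 1, by omega⟩
  have hG : 0 < Real.Gamma (1 - β) := Real.Gamma_pos_of_pos (by linarith)
  have hβ' : 0 < 1 - β := by linarith
  set t : ℝ := ((m + 1 : ℕ) : ℝ) * dt with ht
  have ht₀ : 0 ≤ t := by positivity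
  set K : ℝ → ℝ := fun τ => g' τ * (t - τ) ^ (-β) with hK
  have hinter : ∀ l < m + 1, IntervalIntegrable K volume ((l : ℕ) * dt) ((l + 1 : ℕ) * dt) := by
    intro l hl
    have h1 : (l : ℝ) * dt ≤ (l + 1 : ℕ) * dt := by push_cast; nlinarith
    have h2 : ((l + 1 : ℕ) : ℝ) * dt ≤ t := by
      rw [ht]; gcongr; omega
    refine (intervalIntegrable_sub_rpow hβ₁ t _ _).continuousOn_mul ?_
    rw [Set.uIcc_of_le h1]
    exact (hg.continuousOn_deriv hM).mono (Set.Icc_subset_Icc (by positivity) (h2.trans hnT))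
  have hcap : caputo β g t = 1 / Real.Gamma (1 - β) * ∑ l ∈ Finset.range (m + 1),
      ∫ τ in (l * dt)..((l + 1 : ℕ) * dt), K τ := by
    rw [hg.caputo_eq β ht₀ hnT,
      intervalIntegral.sum_integral_adjacent_intervals (a := fun l : ℕ => (l : ℝ) * dt) hinter]
    simp [ht, hK]
  set H : ℕ → ℝ := fun l =>
    (∑ i, w i * ((1 - Real.exp (-(s i * dt))) / (s i * dt) * Real.exp (-(s i * dt)) ^ (m - l))) *
          (g ((l + 1 : ℕ) * dt) - g (l * dt)) with hH
  have hfid : fidr β dt w s (fun k => g (k * dt)) (m + 1) = 1 / Real.Gamma (1 - β) *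
      (∑ l ∈ Finset.range m, H l + dt ^ (-β) / (1 - β) * (g t - g (m * dt))) := by
    rw [fidr_succ_eq_sum, Finset.sum_range_succ, mul_add, Finset.mul_sum]
    congr 1
    · refine Finset.sum_congr rfl fun l hl => ?_
      have : m - l ≠ 0 := by have := Finset.mem_range.1 hl; omega
      rw [kernelWeight, if_neg this, hH]
      ring
    · rw [Nat.sub_self, kernelWeight, if_pos rfl, Gamma_two_sub hβ₁, Real.rpow_neg hdt.le]
      field_simp
      simp [ht]
  have hhist : |∑ l ∈ Finset.range m, (H l - ∫ τ in (l * dt)..((l + 1 : ℕ) * dt), K τ)| ≤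
      M * dt ^ (2 - β) + M * T * ε := by
    refine (Finset.abs_sum_le_sum_abs _ _).trans ((Finset.sum_le_sum fun l hl =>
      hg.history_cell_error hM hβ₀ hdt hw (Finset.mem_range.1 hl) hnT).trans ?_)
    rw [Finset.sum_add_distrib, ← Finset.mul_sum,
      Finset.sum_range_sub (fun l : ℕ => (((m + 1 : ℕ) : ℝ) * dt - l * dt) ^ (-β)),
      Finset.sum_const, Finset.card_range, nsmul_eq_mul]
    have h1 : ((m + 1 : ℕ) : ℝ) * dt - m * dt = dt := by push_cast; ring
    have h2 : 0 ≤ (((m + 1 : ℕ) : ℝ) * dt - (0 : ℕ) * dt) ^ (-β) := by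
      simp only [Nat.cast_zero, zero_mul, sub_zero]; positivity
    have h3 : dt ^ (2 - β) = dt ^ 2 * dt ^ (-β) := by
      rw [sub_eq_add_neg, Real.rpow_add hdt, Real.rpow_two]
    have h4 : (m : ℝ) * dt ≤ T := le_trans (by rw [ht]; push_cast; nlinarith) hnT
    rw [h1, h3]
    have h5 : M * dt ^ 2 * (dt ^ (-β) - (((m + 1 : ℕ) : ℝ) * dt - (0 : ℕ) * dt) ^ (-β)) ≤
        M * dt ^ 2 * dt ^ (-β) := by gcongr; linarith
    have h6 : M * ε * (m * dt) ≤ M * ε * T := by gcongr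
    linarith
  have hlast := hg.last_cell_error hM hβ₁ hdt hnT
  have hdiff : fidr β dt w s (fun k => g (k * dt)) (m + 1) - caputo β g t =
      1 / Real.Gamma (1 - β) *
        ((∑ l ∈ Finset.range m, (H l - ∫ τ in (l * dt)..((l + 1 : ℕ) * dt), K τ)) +
        (dt ^ (-β) / (1 - β) * (g t - g (m * dt)) -
          ∫ τ in (m * dt)..((m + 1 : ℕ) * dt), K τ)) := by
    rw [hfid, hcap, Finset.sum_range_succ, Finset.sum_sub_distrib]
    ring
  rw [hdiff, abs_mul, abs_of_pos (by positivity)]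
  have hd : 0 ≤ dt ^ (2 - β) := by positivity
  have hT : 0 ≤ T := ht₀.trans hnT
  calc _ ≤ 1 / Real.Gamma (1 - β) *
        (M * dt ^ (2 - β) + M * T * ε + M * dt ^ (2 - β) / (1 - β)) := by
        gcongr
        exact (abs_add_le _ _).trans (add_le_add hhist hlast)
    _ ≤ 1 / Real.Gamma (1 - β) * (M * (1 + 1 / (1 - β) + T) * (dt ^ (2 - β) + ε)) := by
        gcongr
        have : M * (1 + 1 / (1 - β) + T) * (dt ^ (2 - β) + ε) =
          M * dt ^ (2 - β) + M * T * ε + M * dt ^ (2 - β) / (1 - β) +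
            (M * ε + M * ε / (1 - β) + M * T * dt ^ (2 - β)) := by ring
        rw [this]
        have : 0 ≤ M * ε + M * ε / (1 - β) + M * T * dt ^ (2 - β) := by positivity
        linarith
    _ = _ := by ring

end Truncation

section Space

theorem abs_le_pow_succ_of_hasDerivWithinAt {xl xr a C : ℝ} {m : ℕ} {φ φ' : ℝ → ℝ}
    (ha : a ∈ Set.Icc xl xr) (hC : 0 ≤ C)
    (hφ : ∀ y ∈ Set.Icc xl xr, HasDerivWithinAt φ (φ' y) (Set.Icc xl xr) y)
    (hb : ∀ y ∈ Set.Icc xl xr, |φ' y| ≤ C * |y - a| ^ m) (h0 : φ a = 0)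
    {y : ℝ} (hy : y ∈ Set.Icc xl xr) : |φ y| ≤ C * |y - a| ^ (m + 1) := by
  have hsub : Set.uIcc a y ⊆ Set.Icc xl xr := Set.uIcc_subset_Icc ha hy
  have h := Convex.norm_image_sub_le_of_norm_hasDerivWithin_le
    (f := φ) (f' := φ') (C := C * |y - a| ^ m)
    (fun z hz => (hφ z (hsub hz)).mono hsub) (fun z hz => by
      refine (hb z (hsub hz)).trans ?_
      have := Set.abs_sub_left_of_mem_uIcc hz
      gcongr) (convex_uIcc a y) Set.left_mem_uIcc Set.right_mem_uIcc
  rw [h0, sub_zero, Real.norm_eq_abs, Real.norm_eq_abs] at h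
  exact h.trans (le_of_eq (by ring))

theorem taylor_two_bound {xl xr a M : ℝ} {φ : ℕ → ℝ → ℝ} (ha : a ∈ Set.Icc xl xr) (hM : 0 ≤ M)
    (hφ : ∀ k < 3, ∀ y ∈ Set.Icc xl xr, HasDerivWithinAt (φ k) (φ (k + 1) y) (Set.Icc xl xr) y)
    (hb : ∀ y ∈ Set.Icc xl xr, |φ 3 y| ≤ M) {y : ℝ} (hy : y ∈ Set.Icc xl xr) :
    |φ 0 y - φ 0 a - φ 1 a * (y - a) - φ 2 a * (y - a) ^ 2 / 2| ≤ M * |y - a| ^ 3 := by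
  have hid : ∀ y, HasDerivWithinAt (fun y => y - a) 1 (Set.Icc xl xr) y := fun y =>
    (hasDerivWithinAt_id y _).sub_const a
  have h2 : ∀ y ∈ Set.Icc xl xr, |φ 2 y - φ 2 a| ≤ M * |y - a| ^ 1 := fun y hy =>
    abs_le_pow_succ_of_hasDerivWithinAt (m := 0) (φ := fun y => φ 2 y - φ 2 a) ha hM
      (fun y hy => (hφ 2 (by norm_num) y hy).sub_const _) (by simpa using hb) (by simp) hy
  have h1 : ∀ y ∈ Set.Icc xl xr, |φ 1 y - φ 1 a - φ 2 a * (y - a)| ≤ M * |y - a| ^ 2 :=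
    fun y hy => abs_le_pow_succ_of_hasDerivWithinAt (m := 1)
      (φ := fun y => φ 1 y - φ 1 a - φ 2 a * (y - a)) ha hM
      (fun y hy => ((((hφ 1 (by norm_num) y hy).sub_const _).fun_sub
        ((hid y).const_mul _)).congr_deriv (by rw [mul_one]))) h2 (by simp) hy
  refine abs_le_pow_succ_of_hasDerivWithinAt (m := 2)
      (φ := fun y => φ 0 y - φ 0 a - φ 1 a * (y - a) - φ 2 a * (y - a) ^ 2 / 2) ha hM
      (fun y hy => ?_) h1 (by simp) hy
  exact (((((hφ 0 (by norm_num) y hy).sub_const _).fun_sub ((hid y).const_mul _)).fun_sub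
    ((((hid y).fun_pow 2).const_mul (φ 2 a)).div_const 2)).congr_deriv (by simp; ring))

theorem taylor_three_bound {xl xr a M : ℝ} {φ : ℕ → ℝ → ℝ} (ha : a ∈ Set.Icc xl xr) (hM : 0 ≤ M)
    (hφ : ∀ k < 4, ∀ y ∈ Set.Icc xl xr, HasDerivWithinAt (φ k) (φ (k + 1) y) (Set.Icc xl xr) y)
    (hb : ∀ y ∈ Set.Icc xl xr, |φ 4 y| ≤ M) {y : ℝ} (hy : y ∈ Set.Icc xl xr) :
    |φ 0 y - φ 0 a - φ 1 a * (y - a) - φ 2 a * (y - a) ^ 2 / 2 - φ 3 a * (y - a) ^ 3 / 6| ≤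
      M * |y - a| ^ 4 := by
  have hid : ∀ y, HasDerivWithinAt (fun y => y - a) 1 (Set.Icc xl xr) y := fun y =>
    (hasDerivWithinAt_id y _).sub_const a
  refine abs_le_pow_succ_of_hasDerivWithinAt (m := 3) (φ := fun y => φ 0 y - φ 0 a
      - φ 1 a * (y - a) - φ 2 a * (y - a) ^ 2 / 2 - φ 3 a * (y - a) ^ 3 / 6) ha hM
      (fun y hy => ?_) (fun y hy => taylor_two_bound (φ := fun k => φ (k + 1)) ha hM
        (fun k hk => hφ (k + 1) (by omega)) hb hy) (by simp) hy
  exact ((((((hφ 0 (by norm_num) y hy).sub_const _).fun_sub ((hid y).const_mul _)).fun_sub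
    ((((hid y).fun_pow 2).const_mul (φ 2 a)).div_const 2)).fun_sub
    ((((hid y).fun_pow 3).const_mul (φ 3 a)).div_const 6)).congr_deriv (by simp; ring))

theorem hasDerivWithinAt_iteratedDerivWithin {a b : ℝ} (hab : a < b) {F : ℝ → ℝ} {n k : ℕ}
    (hF : ContDiffOn ℝ n F (Set.Icc a b)) (hk : k < n) {y : ℝ} (hy : y ∈ Set.Icc a b) :
    HasDerivWithinAt (iteratedDerivWithin k F (Set.Icc a b))
      (iteratedDerivWithin (k + 1) F (Set.Icc a b) y) (Set.Icc a b) y := by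
  rw [iteratedDerivWithin_succ]
  exact ((hF.differentiableOn_iteratedDerivWithin (by exact_mod_cast hk)
    (uniqueDiffOn_Icc hab)) y hy).hasDerivWithinAt

variable {xl xr T : ℝ} {u : ℝ → ℝ → ℝ}

theorem IsC42.exists_bound (hu : IsC42 xl xr T u) :
    ∃ M : ℝ, 0 ≤ M ∧ ∀ x ∈ Set.Icc xl xr, ∀ t ∈ Set.Icc 0 T,
      (∀ k ≤ 4, |iteratedDerivWithin k (fun x => u x t) (Set.Icc xl xr) x| ≤ M) ∧
      (∀ k ≤ 2, |iteratedDerivWithin k (fun t => u x t) (Set.Icc 0 T) t| ≤ M) := by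
  have hK : IsCompact (Set.Icc xl xr ×ˢ Set.Icc 0 T) := isCompact_Icc.prod isCompact_Icc
  have hx : ∀ k : ℕ, ∃ C : ℝ, k ≤ 4 → ∀ p ∈ Set.Icc xl xr ×ˢ Set.Icc 0 T,
      |iteratedDerivWithin k (fun x => u x p.2) (Set.Icc xl xr) p.1| ≤ C := fun k => by
    by_cases hk : k ≤ 4
    · obtain ⟨C, hC⟩ := hK.exists_bound_of_continuousOn (hu.continuousOn_x k hk)
      exact ⟨C, fun _ => hC⟩
    · exact ⟨0, fun h => absurd h hk⟩
  have ht : ∀ k : ℕ, ∃ C : ℝ, k ≤ 2 → ∀ p ∈ Set.Icc xl xr ×ˢ Set.Icc 0 T,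
      |iteratedDerivWithin k (fun t => u p.1 t) (Set.Icc 0 T) p.2| ≤ C := fun k => by
    by_cases hk : k ≤ 2
    · obtain ⟨C, hC⟩ := hK.exists_bound_of_continuousOn (hu.continuousOn_t k hk)
      exact ⟨C, fun _ => hC⟩
    · exact ⟨0, fun h => absurd h hk⟩
  choose A hA using hx
  choose B hB using ht
  have hle : ∀ (D : ℕ → ℝ) (n k : ℕ), k ≤ n → D k ≤ ∑ j ∈ Finset.range (n + 1), |D j| :=
    fun D n k hk => (le_abs_self _).trans (Finset.single_le_sum (f := fun j => |D j|)
      (fun _ _ => abs_nonneg _) (Finset.mem_range.2 (by omega)))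
  have h1 : 0 ≤ ∑ j ∈ Finset.range (4 + 1), |A j| := Finset.sum_nonneg fun _ _ => abs_nonneg _
  have h2 : 0 ≤ ∑ j ∈ Finset.range (2 + 1), |B j| := Finset.sum_nonneg fun _ _ => abs_nonneg _
  refine ⟨∑ j ∈ Finset.range (4 + 1), |A j| + ∑ j ∈ Finset.range (2 + 1), |B j|,
    add_nonneg h1 h2, fun x hx t ht => ⟨fun k hk => ?_, fun k hk => ?_⟩⟩
  · exact (hA k hk (x, t) ⟨hx, ht⟩).trans ((hle A 4 k hk).trans (by linarith))
  · exact (hB k hk (x, t) ⟨hx, ht⟩).trans ((hle B 2 k hk).trans (by linarith))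

theorem IsC42.hasLipschitzDeriv (hu : IsC42 xl xr T u) (hT : 0 < T) {M x : ℝ}
    (hx : x ∈ Set.Icc xl xr) (hM : ∀ t ∈ Set.Icc 0 T, ∀ k ≤ 2,
      |iteratedDerivWithin k (fun t => u x t) (Set.Icc 0 T) t| ≤ M) :
    HasLipschitzDeriv T M (fun t => u x t)
      (iteratedDerivWithin 1 (fun t => u x t) (Set.Icc 0 T)) where
  hasDeriv τ hτ := by
    simpa using hasDerivWithinAt_iteratedDerivWithin hT (k := 0) (n := 2)
      (hu.contDiffOn_t x hx) (by norm_num) hτ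
  bound τ hτ := hM τ hτ 1 (by norm_num)
  lipschitz τ hτ σ hσ :=
    Convex.norm_image_sub_le_of_norm_hasDerivWithin_le (fun y hy =>
      hasDerivWithinAt_iteratedDerivWithin hT (k := 1) (n := 2) (hu.contDiffOn_t x hx)
        (by norm_num) hy) (fun y hy => hM y hy 2 le_rfl) (convex_Icc 0 T) hσ hτ

theorem IsC42.continuousOn_caputo (hu : IsC42 xl xr T u) (hT : 0 < T) {α t : ℝ} (hα₁ : α < 1)
    (ht : t ∈ Set.Ioc 0 T) :
    ContinuousOn (fun x => caputo α (fun τ => u x τ) t) (Set.Icc xl xr) := by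
  obtain ⟨M, hM₀, hM⟩ := hu.exists_bound
  have heq : Set.EqOn (fun x => caputo α (fun τ => u x τ) t)
      (fun x => 1 / Real.Gamma (1 - α) * ∫ τ in (0 : ℝ)..t,
        iteratedDerivWithin 1 (fun t => u x t) (Set.Icc 0 T) τ * (t - τ) ^ (-α))
      (Set.Icc xl xr) := fun x hx =>
    (hu.hasLipschitzDeriv hT hx fun τ hτ => (hM x hx τ hτ).2).caputo_eq α ht.1.le ht.2
  refine ContinuousOn.congr (continuousOn_const.mul fun x₀ hx₀ => ?_) heq
  have hsub : Set.uIcc 0 t ⊆ Set.Icc 0 T := by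
    rw [Set.uIcc_of_le ht.1.le]; exact Set.Icc_subset_Icc le_rfl ht.2
  have hsub' : Set.uIoc 0 t ⊆ Set.Icc 0 T := Set.uIoc_subset_uIcc.trans hsub
  refine intervalIntegral.continuousWithinAt_of_dominated_interval
    (bound := fun τ => M * (t - τ) ^ (-α)) ?_ ?_
    ((intervalIntegrable_sub_rpow hα₁ t 0 t).const_mul M) ?_
  · filter_upwards [self_mem_nhdsWithin] with x hx
    have hc := (hu.hasLipschitzDeriv hT hx fun τ hτ => (hM x hx τ hτ).2).continuousOn_deriv hM₀
    exact ((intervalIntegrable_sub_rpow hα₁ t 0 t).continuousOn_mul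
      (hc.mono hsub)).def'.aestronglyMeasurable
  · filter_upwards [self_mem_nhdsWithin] with x hx
    refine Filter.Eventually.of_forall fun τ hτ => ?_
    have hτ' := hτ
    rw [Set.uIoc_of_le ht.1.le] at hτ'
    have h0 : 0 ≤ (t - τ) ^ (-α) := Real.rpow_nonneg (by linarith [hτ'.2]) _
    rw [norm_mul, Real.norm_eq_abs, Real.norm_eq_abs, abs_of_nonneg h0]
    exact mul_le_mul_of_nonneg_right ((hM x hx τ (hsub' hτ)).2 1 (by norm_num)) h0
  · refine Filter.Eventually.of_forall fun τ hτ => ContinuousWithinAt.mul ?_ continuousWithinAt_const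
    exact ((hu.continuousOn_t 1 (by norm_num)).comp (f := fun x => (x, τ)) (by fun_prop)
      fun x hx => ⟨hx, hsub' hτ⟩) x₀ hx₀

theorem subset_closure_Ioo {a b : ℝ} (hab : a < b) : Set.Icc a b ⊆ closure (Set.Ioo a b) := by
  rw [closure_Ioo hab.ne]

theorem IsC42.continuousOn_apply (hu : IsC42 xl xr T u) {t : ℝ} (ht : t ∈ Set.Icc 0 T) :
    ContinuousOn (fun x => u x t) (Set.Icc xl xr) := (hu.contDiffOn_x t ht).continuousOn

theorem IsSolution.pde_Icc {α : ℝ} {f : ℝ → ℝ → ℝ} {u₀ : ℝ → ℝ}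
    (hsol : IsSolution α xl xr T f u₀ u) (hu : IsC42 xl xr T u) (hα₁ : α < 1) (hx : xl < xr)
    (hT : 0 < T) (hf : ∀ t ∈ Set.Ioc 0 T, ContinuousOn (fun x => f x t) (Set.Icc xl xr))
    {t : ℝ} (ht : t ∈ Set.Ioc 0 T) {x : ℝ} (hxI : x ∈ Set.Icc xl xr) :
    caputo α (fun τ => u x τ) t
      = iteratedDerivWithin 2 (fun y => u y t) (Set.Icc xl xr) x + f x t := by
  have hc : ContinuousOn (fun x => iteratedDerivWithin 2 (fun y => u y t) (Set.Icc xl xr) x)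
      (Set.Icc xl xr) :=
    (hu.continuousOn_x 2 (by norm_num)).comp (f := fun x => (x, t)) (by fun_prop)
      fun x hx => ⟨hx, Set.Ioc_subset_Icc_self ht⟩
  exact Set.EqOn.of_subset_closure (fun x hx => hsol.pde x hx t ht)
    (hu.continuousOn_caputo hT hα₁ ht) (hc.add (hf t ht)) Set.Ioo_subset_Icc_self
    (subset_closure_Ioo hx) hxI

theorem IsSolution.init_Icc {α : ℝ} {f : ℝ → ℝ → ℝ} {u₀ : ℝ → ℝ}
    (hsol : IsSolution α xl xr T f u₀ u) (hu : IsC42 xl xr T u) (hx : xl < xr) (hT : 0 < T)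
    (hu₀ : ContinuousOn u₀ (Set.Icc xl xr)) {x : ℝ} (hxI : x ∈ Set.Icc xl xr) :
    u x 0 = u₀ x :=
  Set.EqOn.of_subset_closure (fun x hx => hsol.init x hx)
    (hu.continuousOn_apply ⟨le_rfl, hT.le⟩) hu₀ Set.Ioo_subset_Icc_self
    (subset_closure_Ioo hx) hxI

end Space

section Consistency

theorem abs_forward_difference_sub_le {xl xr a h M : ℝ} {φ : ℕ → ℝ → ℝ} (hM : 0 ≤ M) (hh : 0 < h)
    (ha : a ∈ Set.Icc xl xr) (hah : a + h ∈ Set.Icc xl xr)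
    (hφ : ∀ k < 3, ∀ y ∈ Set.Icc xl xr, HasDerivWithinAt (φ k) (φ (k + 1) y) (Set.Icc xl xr) y)
    (hb : ∀ y ∈ Set.Icc xl xr, |φ 3 y| ≤ M) :
    |(φ 0 (a + h) - φ 0 a) / h - φ 1 a - h / 2 * φ 2 a| ≤ M * h ^ 2 := by
  have h1 := taylor_two_bound ha hM hφ hb hah
  rw [add_sub_cancel_left, abs_of_pos hh] at h1
  have h2 : (φ 0 (a + h) - φ 0 a) / h - φ 1 a - h / 2 * φ 2 a =
      (φ 0 (a + h) - φ 0 a - φ 1 a * h - φ 2 a * h ^ 2 / 2) / h := by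
    field_simp
  rw [h2, abs_div, abs_of_pos hh, div_le_iff₀ hh]
  exact h1.trans (le_of_eq (by ring))

theorem abs_backward_difference_sub_le {xl xr a h M : ℝ} {φ : ℕ → ℝ → ℝ} (hM : 0 ≤ M)
    (hh : 0 < h) (ha : a ∈ Set.Icc xl xr) (hah : a - h ∈ Set.Icc xl xr)
    (hφ : ∀ k < 3, ∀ y ∈ Set.Icc xl xr, HasDerivWithinAt (φ k) (φ (k + 1) y) (Set.Icc xl xr) y)
    (hb : ∀ y ∈ Set.Icc xl xr, |φ 3 y| ≤ M) :
    |(φ 0 a - φ 0 (a - h)) / h - φ 1 a + h / 2 * φ 2 a| ≤ M * h ^ 2 := by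
  have h1 := taylor_two_bound ha hM hφ hb hah
  rw [sub_sub_cancel_left, abs_neg, abs_of_pos hh] at h1
  have h2 : (φ 0 a - φ 0 (a - h)) / h - φ 1 a + h / 2 * φ 2 a =
      -(φ 0 (a - h) - φ 0 a - φ 1 a * -h - φ 2 a * (-h) ^ 2 / 2) / h := by
    field_simp
    ring
  rw [h2, abs_div, abs_neg, abs_of_pos hh, div_le_iff₀ hh]
  exact h1.trans (le_of_eq (by ring))

theorem abs_second_difference_sub_le {xl xr a h M : ℝ} {φ : ℕ → ℝ → ℝ} (hM : 0 ≤ M) (hh : 0 < h)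
    (ha : a ∈ Set.Icc xl xr) (hp : a + h ∈ Set.Icc xl xr) (hm : a - h ∈ Set.Icc xl xr)
    (hφ : ∀ k < 4, ∀ y ∈ Set.Icc xl xr, HasDerivWithinAt (φ k) (φ (k + 1) y) (Set.Icc xl xr) y)
    (hb : ∀ y ∈ Set.Icc xl xr, |φ 4 y| ≤ M) :
    |((φ 0 (a + h) - φ 0 a) / h - (φ 0 a - φ 0 (a - h)) / h) / h - φ 2 a| ≤ 2 * M * h ^ 2 := by
  have h1 := taylor_three_bound ha hM hφ hb hp
  have h2 := taylor_three_bound ha hM hφ hb hm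
  rw [add_sub_cancel_left, abs_of_pos hh] at h1
  rw [sub_sub_cancel_left, abs_neg, abs_of_pos hh] at h2
  have h3 : ((φ 0 (a + h) - φ 0 a) / h - (φ 0 a - φ 0 (a - h)) / h) / h - φ 2 a =
      ((φ 0 (a + h) - φ 0 a - φ 1 a * h - φ 2 a * h ^ 2 / 2 - φ 3 a * h ^ 3 / 6) +
      (φ 0 (a - h) - φ 0 a - φ 1 a * -h - φ 2 a * (-h) ^ 2 / 2 - φ 3 a * (-h) ^ 3 / 6)) /
        h ^ 2 := by
    field_simp
    ring
  rw [h3, abs_div, abs_of_pos (by positivity : 0 < h ^ 2), div_le_iff₀ (by positivity)]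
  refine (abs_add_le _ _).trans ((add_le_add h1 h2).trans (le_of_eq (by ring)))

theorem mesh_mem_Icc {xl xr h : ℝ} {NS : ℕ} (hNS : 0 < NS) (hx : xl < xr)
    (hh : h = (xr - xl) / NS) {i : ℕ} (hi : i ≤ NS) : xl + i * h ∈ Set.Icc xl xr := by
  have hN : (0 : ℝ) < NS := by exact_mod_cast hNS
  have hh₀ : 0 < h := by rw [hh]; exact div_pos (by linarith) hN
  have hL : NS * h = xr - xl := by rw [hh]; field_simp
  have hi' : (i : ℝ) ≤ NS := by exact_mod_cast hi
  constructor
  · have : 0 ≤ (i : ℝ) * h := by positivity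
    linarith
  · nlinarith

/-- The constant in the truncation error of the FIDR operator of order `β`. -/
noncomputable def truncConst (M T β : ℝ) : ℝ := M * (1 + 1 / (1 - β) + T) / Real.Gamma (1 - β)

theorem truncConst_nonneg {M T β : ℝ} (hM : 0 ≤ M) (hT : 0 < T) (hβ : β < 1) :
    0 ≤ truncConst M T β := by
  have hG : 0 < Real.Gamma (1 - β) := Real.Gamma_pos_of_pos (by linarith)
  have : 0 < 1 - β := by linarith
  rw [truncConst]
  positivity

theorem exists_consistency {α xl xr T : ℝ} (hα₀ : 0 < α) (hα₁ : α < 1) (hx : xl < xr)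
    (hT : 0 < T) {f : ℝ → ℝ → ℝ} {u₀ : ℝ → ℝ} {u : ℝ → ℝ → ℝ}
    (hf : ∀ t ∈ Set.Ioc 0 T, ContinuousOn (fun x => f x t) (Set.Icc xl xr))
    (hu : IsC42 xl xr T u) (hsol : IsSolution α xl xr T f u₀ u) :
    ∃ C : ℝ, 0 < C ∧ ∀ (NS : ℕ) (dt h ε : ℝ), 0 < NS → 0 < dt → h = (xr - xl) / NS → 0 ≤ ε →
      ∀ (N N' : ℕ) (w s : Fin N → ℝ) (w' s' : Fin N' → ℝ),
        IsSumOfExp α dt T ε w s → IsSumOfExp (α / 2) dt T ε w' s' →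
      ∀ n : ℕ, 1 ≤ n → n * dt ≤ T →
        (∀ i, 1 ≤ i → i < NS →
          |fidr α dt w s (fun k => u (xl + i * h) (k * dt)) n
            - dxx h (fun j => u (xl + j * h) (n * dt)) i - f (xl + i * h) (n * dt)| ≤
            C * (dt ^ (2 - α) + h ^ 2 + ε)) ∧
        |h / 2 * (fidr α dt w s (fun k => u xl (k * dt)) n - f xl (n * dt))
            - dx h (fun j => u (xl + j * h) (n * dt)) 0
            + fidr (α / 2) dt w' s' (fun k => u xl (k * dt)) n| ≤
            C * (dt ^ (2 - α) + h ^ 2 + ε) ∧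
        |h / 2 * (fidr α dt w s (fun k => u xr (k * dt)) n - f xr (n * dt))
            + dx h (fun j => u (xl + j * h) (n * dt)) (NS - 1)
            + fidr (α / 2) dt w' s' (fun k => u xr (k * dt)) n| ≤
            C * (dt ^ (2 - α) + h ^ 2 + ε) := by
  obtain ⟨M, hM₀, hM⟩ := hu.exists_bound
  set K := truncConst M T α with hK
  set K' := truncConst M T (α / 2) with hK'
  have hK₀ : 0 ≤ K := truncConst_nonneg hM₀ hT hα₁
  have hK₀' : 0 ≤ K' := truncConst_nonneg hM₀ hT (by linarith)
  have hL : 0 < xr - xl := by linarith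
  have hTα : 0 < T ^ (α / 2) := by positivity
  refine ⟨K + 2 * M + (xr - xl) / 2 * K + K' * (1 + T ^ (α / 2)) + 1, by positivity, ?_⟩
  intro NS dt h ε hNS hdt hh hε N N' w s w' s' hw hw' n hn hnT
  have hn' : (1 : ℝ) ≤ n := by exact_mod_cast hn
  have hN : (1 : ℝ) ≤ NS := by exact_mod_cast hNS
  have hh₀ : 0 < h := by rw [hh]; exact div_pos hL (by linarith)
  have hNh : NS * h = xr - xl := by rw [hh]; field_simp
  have hhL : h ≤ xr - xl := by nlinarith
  have hdT : dt ≤ T := by nlinarith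
  have ht : n * dt ∈ Set.Ioc 0 T := ⟨by positivity, hnT⟩
  have ht' : n * dt ∈ Set.Icc 0 T := Set.Ioc_subset_Icc_self ht
  have hd : 0 < dt ^ (2 - α) := by positivity
  have hd' : dt ^ (2 - α / 2) ≤ T ^ (α / 2) * dt ^ (2 - α) := by
    rw [show 2 - α / 2 = α / 2 + (2 - α) by ring, Real.rpow_add hdt]
    gcongr
  have hmem : ∀ i ≤ NS, xl + i * h ∈ Set.Icc xl xr := fun i hi => mesh_mem_Icc hNS hx hh hi
  have htime : ∀ x ∈ Set.Icc xl xr,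
      |fidr α dt w s (fun k => u x (k * dt)) n - caputo α (fun τ => u x τ) (n * dt)| ≤
        K * (dt ^ (2 - α) + ε) := fun x hxI =>
    (hu.hasLipschitzDeriv hT hxI fun τ hτ => (hM x hxI τ hτ).2).abs_fidr_sub_caputo_le
      hM₀ hα₀ hα₁ hdt hε hw hn hnT
  have htime' : ∀ x ∈ Set.Icc xl xr,
      |fidr (α / 2) dt w' s' (fun k => u x (k * dt)) n
        - caputo (α / 2) (fun τ => u x τ) (n * dt)| ≤ K' * (dt ^ (2 - α / 2) + ε) := fun x hxI =>
    (hu.hasLipschitzDeriv hT hxI fun τ hτ => (hM x hxI τ hτ).2).abs_fidr_sub_caputo_le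
      hM₀ (by linarith) (by linarith) hdt hε hw' hn hnT
  have hpde : ∀ x ∈ Set.Icc xl xr, _ := fun x hxI => hsol.pde_Icc hu hα₁ hx hT hf ht hxI
  set φ : ℕ → ℝ → ℝ := fun k =>
    iteratedDerivWithin k (fun x => u x (n * dt)) (Set.Icc xl xr) with hφdef
  have hφ0 : ∀ x, φ 0 x = u x (n * dt) := fun x => by simp [hφdef]
  have hφ : ∀ k < 4, ∀ y ∈ Set.Icc xl xr,
      HasDerivWithinAt (φ k) (φ (k + 1) y) (Set.Icc xl xr) y := fun k hk y hy =>
    hasDerivWithinAt_iteratedDerivWithin hx (n := 4) (hu.contDiffOn_x _ ht') hk hy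
  have hφM : ∀ k ≤ 4, ∀ y ∈ Set.Icc xl xr, |φ k y| ≤ M := fun k hk y hy =>
    (hM y hy _ ht').1 k hk
  have hφ' : ∀ k < 3, ∀ y ∈ Set.Icc xl xr,
      HasDerivWithinAt (φ k) (φ (k + 1) y) (Set.Icc xl xr) y := fun k hk => hφ k (by omega)
  set E := dt ^ (2 - α) + h ^ 2 + ε with hE
  have hE₀ : 0 ≤ E := by positivity
  have hdE : dt ^ (2 - α) + ε ≤ E := by rw [hE]; nlinarith [sq_nonneg h]
  have hhE : h ^ 2 ≤ E := by rw [hE]; linarith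
  have hbK : h / 2 * (K * (dt ^ (2 - α) + ε)) ≤ (xr - xl) / 2 * (K * E) := by gcongr
  have hbK' : K' * (dt ^ (2 - α / 2) + ε) ≤ K' * (1 + T ^ (α / 2)) * E := by
    rw [mul_assoc]
    gcongr
    have : T ^ (α / 2) * dt ^ (2 - α) ≤ T ^ (α / 2) * E := by gcongr; linarith
    linarith
  have hbM : M * h ^ 2 ≤ M * E := by gcongr
  have hbI : K * (dt ^ (2 - α) + ε) ≤ K * E := by gcongr
  have hKE : 0 ≤ K * E := by positivity
  have hME : 0 ≤ M * E := by positivity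
  have hLKE : 0 ≤ (xr - xl) / 2 * (K * E) := by positivity
  have hKE' : 0 ≤ K' * (1 + T ^ (α / 2)) * E := by positivity
  have hxl : xl ∈ Set.Icc xl xr := Set.left_mem_Icc.2 hx.le
  have hxr : xr ∈ Set.Icc xl xr := Set.right_mem_Icc.2 hx.le
  have hCE : (K + 2 * M + (xr - xl) / 2 * K + K' * (1 + T ^ (α / 2)) + 1) * E =
      K * E + 2 * (M * E) + (xr - xl) / 2 * (K * E) + K' * (1 + T ^ (α / 2)) * E + E := by ring
  rw [hCE]
  have hbdry : ∀ x ∈ Set.Icc xl xr, ∀ d σ : ℝ,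
      |d - σ * φ 1 x - h / 2 * φ 2 x| ≤ M * h ^ 2 →
      σ * φ 1 x = caputo (α / 2) (fun τ => u x τ) (n * dt) →
      |h / 2 * (fidr α dt w s (fun k => u x (k * dt)) n - f x (n * dt)) - d
        + fidr (α / 2) dt w' s' (fun k => u x (k * dt)) n| ≤
      K * E + 2 * (M * E) + (xr - xl) / 2 * (K * E) + K' * (1 + T ^ (α / 2)) * E + E := by
    intro x hxI d σ hdσ hσ
    have e1 := htime x hxI
    have e2 := htime' x hxI
    have e3 : |h / 2 * (fidr α dt w s (fun k => u x (k * dt)) n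
        - caputo α (fun τ => u x τ) (n * dt))| ≤ h / 2 * (K * (dt ^ (2 - α) + ε)) := by
      rw [abs_mul, abs_of_pos (by positivity)]; gcongr
    have e4 := hpde x hxI
    rw [← hσ] at e2
    have e5 : h / 2 * (fidr α dt w s (fun k => u x (k * dt)) n - f x (n * dt)) - d
        + fidr (α / 2) dt w' s' (fun k => u x (k * dt)) n =
        h / 2 * (fidr α dt w s (fun k => u x (k * dt)) n - caputo α (fun τ => u x τ) (n * dt))
        - (d - σ * φ 1 x - h / 2 * φ 2 x)
        + (fidr (α / 2) dt w' s' (fun k => u x (k * dt)) n - σ * φ 1 x) := by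
      rw [e4]; ring
    rw [e5]
    refine (abs_add_le _ _).trans ?_
    have := abs_sub (h / 2 * (fidr α dt w s (fun k => u x (k * dt)) n
      - caputo α (fun τ => u x τ) (n * dt))) (d - σ * φ 1 x - h / 2 * φ 2 x)
    linarith
  refine ⟨fun i hi hiN => ?_, ?_, ?_⟩
  · obtain ⟨j, rfl⟩ : ∃ j, i = j + 1 := ⟨i - 1, by omega⟩
    have hxi := hmem (j + 1) hiN.le
    have hp : xl + (j + 1 : ℕ) * h + h = xl + (j + 1 + 1 : ℕ) * h := by push_cast; ring
    have hm : xl + (j + 1 : ℕ) * h - h = xl + j * h := by push_cast; ring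
    have e1 := htime _ hxi
    have e2 := abs_second_difference_sub_le hM₀ hh₀ hxi (by rw [hp]; exact hmem _ hiN)
      (by rw [hm]; exact hmem _ (by omega)) hφ (hφM 4 le_rfl)
    have e4 := hpde _ hxi
    rw [hp, hm] at e2
    simp only [hφ0] at e2
    simp only [dxx, dx, Nat.add_sub_cancel]
    rw [abs_le] at e1 e2 ⊢
    constructor <;> linarith [e1.1, e1.2, e2.1, e2.2]
  · have e := abs_forward_difference_sub_le hM₀ hh₀ hxl (by simpa using hmem 1 hNS) hφ'
      (hφM 3 (by norm_num))
    refine hbdry xl hxl _ 1 ?_ ?_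
    · simpa [dx, hφ0] using e
    · rw [one_mul, ← hsol.left _ ht]
      simp [hφdef]
  · obtain ⟨j, rfl⟩ : ∃ j, NS = j + 1 := ⟨NS - 1, by omega⟩
    have hr : xl + ((j + 1 : ℕ) : ℝ) * h = xr := by linarith
    have hm : xr - h = xl + j * h := by rw [← hr]; push_cast; ring
    have e := abs_backward_difference_sub_le hM₀ hh₀ hxr (by rw [hm]; exact hmem _ (by omega)) hφ'
      (hφM 3 (by norm_num))
    have := hbdry xr hxr (-dx h (fun j => u (xl + j * h) (n * dt)) j) (-1) ?_ ?_
    · simpa [sub_neg_eq_add] using this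
    · rw [← abs_neg]
      rw [hm] at e
      simp only [hφ0] at e
      rw [dx, hr]
      convert e using 2
      ring
    · have := hsol.right _ ht
      rw [← iteratedDerivWithin_one] at this
      simp only [hφdef]
      linarith

end Consistency

section Energy

/-- The composite trapezoidal sum with `N` cells of size `h`. -/
noncomputable def trapezoid (h : ℝ) (N : ℕ) (φ : ℕ → ℝ) : ℝ :=
  ∑ i ∈ Finset.range N, h / 2 * (φ i + φ (i + 1))

theorem trapezoid_eq (h : ℝ) {N : ℕ} (hN : 1 ≤ N) (φ : ℕ → ℝ) :
    trapezoid h N φ = h / 2 * φ 0 + h / 2 * φ N + ∑ i ∈ Finset.Ico 1 N, h * φ i := by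
  induction N, hN using Nat.le_induction with
  | base => simp [trapezoid]; ring
  | succ N hN ih =>
    rw [trapezoid, Finset.sum_range_succ, ← trapezoid, ih, Finset.sum_Ico_succ_top hN]
    ring

theorem sum_dx_sq_eq {h : ℝ} (hh : h ≠ 0) {N : ℕ} (hN : 1 ≤ N) (v : ℕ → ℝ) :
    ∑ i ∈ Finset.range N, h * dx h v i ^ 2 =
      v N * dx h v (N - 1) - v 0 * dx h v 0 - ∑ i ∈ Finset.Ico 1 N, h * (v i * dxx h v i) := by
  induction N, hN using Nat.le_induction with
  | base =>
    simp only [Finset.range_one, Finset.sum_singleton, Finset.Ico_self, Finset.sum_empty, dx]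
    field_simp
    ring
  | succ N hN ih =>
    rw [Finset.sum_range_succ, ih, Finset.sum_Ico_succ_top hN, Nat.add_sub_cancel]
    have h1 : h * (v N * dxx h v N) = v N * (dx h v N - dx h v (N - 1)) := by
      rw [dxx]; field_simp
    have h2 : h * dx h v N ^ 2 = (v (N + 1) - v N) * dx h v N := by
      simp only [dx]; field_simp
    rw [h1, h2]
    ring

theorem sq_le_discrete_sobolev {h r : ℝ} (hh : 0 < h) (hr : 0 < r) {N : ℕ} (hN : 1 ≤ N)
    (v : ℕ → ℝ) {i : ℕ} (hi : i ≤ N) :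
    v i ^ 2 ≤ trapezoid h N (fun j => v j ^ 2) / (N * h)
      + 1 / (2 * r) * ∑ j ∈ Finset.range N, h * dx h v j ^ 2
      + 2 * r * trapezoid h N (fun j => v j ^ 2) := by
  set c : ℕ → ℝ := fun j => 1 / (2 * r) * (h * dx h v j ^ 2)
    + 2 * r * (h / 2 * (v j ^ 2 + v (j + 1) ^ 2)) with hc
  have hc₀ : ∀ j, 0 ≤ c j := fun j => by simp only [hc]; positivity
  have hstep : ∀ j, dist (v j ^ 2) (v (j + 1) ^ 2) ≤ c j := by
    intro j
    have hv : v (j + 1) = v j + h * dx h v j := by simp only [dx]; field_simp; ring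
    rw [dist_comm, Real.dist_eq]
    set a := h * dx h v j with ha
    set b := v (j + 1) + v j with hb
    have h1 : v (j + 1) ^ 2 - v j ^ 2 = a * b := by rw [hb, hv]; ring
    have h2 : c j = a ^ 2 / (2 * r * h) + r * h * (v j ^ 2 + v (j + 1) ^ 2) := by
      simp only [hc, ha]; field_simp
    have h3 : b ^ 2 ≤ 2 * (v j ^ 2 + v (j + 1) ^ 2) := by
      rw [hb]; nlinarith [sq_nonneg (v (j + 1) - v j)]
    have h4 : r * h * b ^ 2 / 2 ≤ r * h * (v j ^ 2 + v (j + 1) ^ 2) := by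
      have : 0 < r * h := by positivity
      nlinarith
    have h5 : |a * b| ≤ a ^ 2 / (2 * r * h) + r * h * b ^ 2 / 2 := by
      have e1 : a ^ 2 / (2 * r * h) + r * h * b ^ 2 / 2 - a * b =
          (a - r * h * b) ^ 2 / (2 * r * h) := by field_simp; ring
      have e2 : a ^ 2 / (2 * r * h) + r * h * b ^ 2 / 2 + a * b =
          (a + r * h * b) ^ 2 / (2 * r * h) := by field_simp; ring
      have e3 : 0 ≤ (a - r * h * b) ^ 2 / (2 * r * h) := by positivity
      have e4 : 0 ≤ (a + r * h * b) ^ 2 / (2 * r * h) := by positivity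
      rw [abs_le]
      constructor <;> linarith
    rw [h1, h2]
    linarith
  set Q := ∑ j ∈ Finset.range N, c j with hQ
  have hchain : ∀ p q, p ≤ q → q ≤ N → dist (v p ^ 2) (v q ^ 2) ≤ Q := by
    intro p q hpq hq
    refine (dist_le_Ico_sum_of_dist_le (f := fun j => v j ^ 2) hpq
      fun _ _ => hstep _).trans ?_
    refine Finset.sum_le_sum_of_subset_of_nonneg (fun j hj => ?_) fun j _ _ => hc₀ j
    have := Finset.mem_Ico.1 hj
    exact Finset.mem_range.2 (by omega)
  have hall : ∀ j ≤ N, v i ^ 2 ≤ v j ^ 2 + Q := by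
    intro j hj
    rcases le_total i j with hij | hij
    · have := hchain i j hij hj
      rw [Real.dist_eq, abs_le] at this
      linarith [this.2]
    · have := hchain j i hij hi
      rw [Real.dist_eq, abs_le] at this
      linarith [this.1]
  have hNh : 0 < N * h := by positivity
  have havg : N * h * v i ^ 2 ≤ trapezoid h N (fun j => v j ^ 2) + N * h * Q := by
    have h1 : N * h * (v i ^ 2 - Q) = ∑ j ∈ Finset.range N, h * (v i ^ 2 - Q) := by
      rw [Finset.sum_const, Finset.card_range, nsmul_eq_mul]; ring
    have h2 : ∑ j ∈ Finset.range N, h * (v i ^ 2 - Q) ≤ trapezoid h N (fun j => v j ^ 2) := by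
      refine Finset.sum_le_sum fun j hj => ?_
      have hj := Finset.mem_range.1 hj
      have := hall j hj.le
      have := hall (j + 1) hj
      nlinarith
    linarith
  have hQeq : Q = 1 / (2 * r) * ∑ j ∈ Finset.range N, h * dx h v j ^ 2
      + 2 * r * trapezoid h N (fun j => v j ^ 2) := by
    rw [hQ, trapezoid, Finset.mul_sum, Finset.mul_sum, ← Finset.sum_add_distrib]
  have : v i ^ 2 ≤ (trapezoid h N (fun j => v j ^ 2) + N * h * Q) / (N * h) := by
    rw [le_div_iff₀ hNh]; linarith
  rw [add_div, mul_div_cancel_left₀ _ hNh.ne', hQeq] at this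
  linarith

/-- The discrete energy estimate at a fixed time level. -/
theorem energy_level_le {h m p R : ℝ} (hh : 0 < h) (hm : 0 < m) (hp : 0 < p) {N : ℕ} (hN : 1 ≤ N)
    {v A : ℕ → ℝ} {B B' : ℝ}
    (hinter : ∀ i, 1 ≤ i → i < N → |A i - dxx h v i| ≤ R)
    (hleft : |h / 2 * A 0 - dx h v 0 + B| ≤ R)
    (hright : |h / 2 * A N + dx h v (N - 1) + B'| ≤ R) :
    trapezoid h N (fun i => v i * A i) + ∑ i ∈ Finset.range N, h * dx h v i ^ 2
        + v 0 * B + v N * B' ≤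
      m / 2 * trapezoid h N (fun i => v i ^ 2) + p * v 0 ^ 2 + p * v N ^ 2
        + (N * h * R ^ 2 / (2 * m) + R ^ 2 / (2 * p)) := by
  have young : ∀ {a b q : ℝ}, 0 < q → |b| ≤ R → a * b ≤ q * a ^ 2 + R ^ 2 / (4 * q) := by
    intro a b q hq hb
    have h1 : b ^ 2 ≤ R ^ 2 := sq_le_sq' (by linarith [neg_abs_le b]) ((le_abs_self b).trans hb)
    have h2 : q * a ^ 2 + b ^ 2 / (4 * q) - a * b = (2 * q * a - b) ^ 2 / (4 * q) := by
      field_simp; ring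
    have h3 : 0 ≤ (2 * q * a - b) ^ 2 / (4 * q) := by positivity
    have h4 : b ^ 2 / (4 * q) ≤ R ^ 2 / (4 * q) := by gcongr
    linarith
  have hid : trapezoid h N (fun i => v i * A i) + ∑ i ∈ Finset.range N, h * dx h v i ^ 2
        + v 0 * B + v N * B' =
      v 0 * (h / 2 * A 0 - dx h v 0 + B) + v N * (h / 2 * A N + dx h v (N - 1) + B')
        + ∑ i ∈ Finset.Ico 1 N, h * (v i * (A i - dxx h v i)) := by
    rw [trapezoid_eq h hN, sum_dx_sq_eq hh.ne' hN]
    simp only [mul_sub, Finset.sum_sub_distrib]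
    ring
  have hsum : ∑ i ∈ Finset.Ico 1 N, h * (v i * (A i - dxx h v i)) ≤
      m / 2 * trapezoid h N (fun i => v i ^ 2) + N * h * R ^ 2 / (2 * m) := by
    calc _ ≤ ∑ i ∈ Finset.Ico 1 N, (m / 2 * (h * v i ^ 2) + h * (R ^ 2 / (2 * m))) := by
          refine Finset.sum_le_sum fun i hi => ?_
          have hi := Finset.mem_Ico.1 hi
          have := young (a := v i) (q := m / 2) (by positivity) (hinter i hi.1 hi.2)
          rw [show 4 * (m / 2) = 2 * m by ring] at this
          have := mul_le_mul_of_nonneg_left this hh.le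
          linarith
      _ ≤ _ := by
          rw [Finset.sum_add_distrib, ← Finset.mul_sum, Finset.sum_const, Nat.card_Ico,
            nsmul_eq_mul, trapezoid_eq h hN]
          have h1 : ((N - 1 : ℕ) : ℝ) ≤ N := by exact_mod_cast Nat.sub_le N 1
          have h2 : ((N - 1 : ℕ) : ℝ) * (h * (R ^ 2 / (2 * m))) ≤ N * (h * (R ^ 2 / (2 * m))) := by
            gcongr
          have h3 : 0 ≤ m / 2 * (h / 2 * v 0 ^ 2 + h / 2 * v N ^ 2) := by positivity
          have h4 : N * h * R ^ 2 / (2 * m) = N * (h * (R ^ 2 / (2 * m))) := by ring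
          rw [h4]
          linarith
  have e1 := young (a := v 0) hp hleft
  have e2 := young (a := v N) hp hright
  have e3 : R ^ 2 / (2 * p) = R ^ 2 / (4 * p) + R ^ 2 / (4 * p) := by field_simp; ring
  rw [hid]
  linarith

theorem sum_trapezoid (h : ℝ) (N n : ℕ) (φ : ℕ → ℕ → ℝ) :
    ∑ k ∈ Finset.range n, trapezoid h N (fun i => φ i k) =
      trapezoid h N (fun i => ∑ k ∈ Finset.range n, φ i k) := by
  simp only [trapezoid]
  rw [Finset.sum_comm]
  simp only [Finset.mul_sum, ← Finset.sum_add_distrib, mul_add]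

/-- The discrete energy estimate summed over the time levels. -/
theorem sum_energy_le {h m p R : ℝ} (hh : 0 < h) (hm : 0 < m) (hp : 0 < p) {N n : ℕ} (hN : 1 ≤ N)
    {v A : ℕ → ℕ → ℝ} {B B' : ℕ → ℝ}
    (hinter : ∀ k < n, ∀ i, 1 ≤ i → i < N → |A i k - dxx h (fun j => v j k) i| ≤ R)
    (hleft : ∀ k < n, |h / 2 * A 0 k - dx h (fun j => v j k) 0 + B k| ≤ R)
    (hright : ∀ k < n, |h / 2 * A N k + dx h (fun j => v j k) (N - 1) + B' k| ≤ R)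
    (hA : ∀ i ≤ N, m * ∑ k ∈ Finset.range n, v i k ^ 2 ≤ ∑ k ∈ Finset.range n, v i k * A i k)
    (hB : p * ∑ k ∈ Finset.range n, v 0 k ^ 2 ≤ ∑ k ∈ Finset.range n, v 0 k * B k)
    (hB' : p * ∑ k ∈ Finset.range n, v N k ^ 2 ≤ ∑ k ∈ Finset.range n, v N k * B' k) :
    ∑ k ∈ Finset.range n, (m / 2 * trapezoid h N (fun i => v i k ^ 2)
        + ∑ i ∈ Finset.range N, h * dx h (fun j => v j k) i ^ 2) ≤
      n * (N * h * R ^ 2 / (2 * m) + R ^ 2 / (2 * p)) := by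
  have hlev := Finset.sum_le_sum fun k hk => energy_level_le (v := fun i => v i k)
    (A := fun i => A i k) hh hm hp hN (hinter k (Finset.mem_range.1 hk))
    (hleft k (Finset.mem_range.1 hk)) (hright k (Finset.mem_range.1 hk))
  simp only [Finset.sum_add_distrib, ← Finset.mul_sum, Finset.sum_const, Finset.card_range,
    nsmul_eq_mul] at hlev ⊢
  have htrap : m * ∑ k ∈ Finset.range n, trapezoid h N (fun i => v i k ^ 2) ≤
      ∑ k ∈ Finset.range n, trapezoid h N (fun i => v i k * A i k) := by
    rw [sum_trapezoid h N n fun i k => v i k ^ 2, sum_trapezoid h N n fun i k => v i k * A i k,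
      trapezoid, trapezoid, Finset.mul_sum]
    refine Finset.sum_le_sum fun i hi => ?_
    have hi := Finset.mem_range.1 hi
    have h1 := hA i hi.le
    have h2 := hA (i + 1) hi
    rw [mul_left_comm]
    refine mul_le_mul_of_nonneg_left ?_ (by positivity)
    linarith
  linarith

end Energy

theorem dx_sub (h : ℝ) (v v' : ℕ → ℝ) (i : ℕ) :
    dx h (fun j => v j - v' j) i = dx h v i - dx h v' i := by
  simp only [dx]; ring

theorem dxx_sub (h : ℝ) (v v' : ℕ → ℝ) (i : ℕ) :
    dxx h (fun j => v j - v' j) i = dxx h v i - dxx h v' i := by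
  simp only [dxx, dx_sub]; ring

theorem exists_errorNorm_eq (xl h dt : ℝ) (NS : ℕ) (u : ℝ → ℝ → ℝ) (U : ℕ → ℕ → ℝ) (k : ℕ) :
    ∃ i ≤ NS, errorNorm xl h dt NS u U k = |U i k - u (xl + i * h) (k * dt)| := by
  obtain ⟨i, -, hi⟩ := Finset.exists_max_image Finset.univ
    (fun i : Fin (NS + 1) => ‖U i k - u (xl + (i : ℕ) * h) (k * dt)‖) Finset.univ_nonempty
  refine ⟨i, Nat.lt_succ_iff.1 i.2, le_antisymm ?_ ?_⟩
  · exact (pi_norm_le_iff_of_nonneg (abs_nonneg _)).2 fun j => hi j (Finset.mem_univ j)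
  · exact norm_le_pi_norm
      (fun i : Fin (NS + 1) => U i k - u (xl + (i : ℕ) * h) (k * dt)) i

theorem sobolev_factor_le {c L μ : ℝ} (hc : 0 < c) (hc₁ : c ≤ 1) (hL : 0 < L) (hμ : 0 < μ) :
    2 / (c * μ * L) + 4 / √(c * μ) ≤ 4 / c * ((1 + √(1 + L ^ 2 * μ)) / (L * μ)) := by
  have hsμ : 0 < √μ := Real.sqrt_pos.2 hμ
  have h1 : c * √μ ≤ √(c * μ) := by
    rw [Real.sqrt_mul hc.le]
    gcongr
    rw [Real.le_sqrt hc.le hc.le]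
    nlinarith
  have h2 : 4 / √(c * μ) ≤ 4 / (c * √μ) := by gcongr
  have h3 : L * √μ ≤ √(1 + L ^ 2 * μ) := by
    rw [Real.le_sqrt (by positivity) (by positivity), mul_pow, Real.sq_sqrt hμ.le]
    linarith
  have h4 : 4 / (c * √μ) = 4 / c * (L * √μ / (L * μ)) := by
    have h : √μ * √μ = μ := Real.mul_self_sqrt hμ.le
    rw [mul_div_mul_left _ _ hL.ne', ← div_div, div_eq_mul_inv, inv_eq_one_div]
    congr 1
    rw [div_eq_div_iff hsμ.ne' hμ.ne', one_mul, h]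
  have h5 : 4 / c * (L * √μ / (L * μ)) ≤ 4 / c * (√(1 + L ^ 2 * μ) / (L * μ)) := by gcongr
  have h6 : 2 / (c * μ * L) ≤ 4 / c * (1 / (L * μ)) := by
    have e : 4 / c * (1 / (L * μ)) = 2 / (c * μ * L) + 2 / (c * μ * L) := by field_simp; ring
    have : 0 ≤ 2 / (c * μ * L) := by positivity
    linarith
  rw [add_div, mul_add]
  linarith

theorem errorConst_pos {c₁ T L μ ν : ℝ} (hc : 0 < c₁) (hT : 0 < T) (hL : 0 < L) (hμ : 0 < μ)
    (hν : 0 < ν) : 0 < errorConst c₁ T L μ ν := by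
  rw [errorConst]
  positivity

/-- The maximum norm estimate that follows from the energy estimate. -/
theorem sum_sup_norm_sq_le {h c μ ν R : ℝ} (hh : 0 < h) (hc : 0 < c) (hc₁ : c ≤ 1) (hμ : 0 < μ)
    (hν : 0 < ν) {N n : ℕ} (hN : 1 ≤ N) {v : ℕ → ℕ → ℝ} {b : ℕ → ℝ}
    (hen : ∑ k ∈ Finset.range n, (c * μ / 2 * trapezoid h N (fun i => v i k ^ 2)
        + ∑ i ∈ Finset.range N, h * dx h (fun j => v j k) i ^ 2) ≤
      n * (N * h * R ^ 2 / (2 * (c * μ)) + R ^ 2 / (2 * (c * ν))))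
    (hb : ∀ k < n, ∃ i ≤ N, b k = v i k ^ 2) :
    ∑ k ∈ Finset.range n, b k ≤
      4 * (R / c) ^ 2 * n * ((1 + √(1 + (N * h) ^ 2 * μ)) / (N * h * μ))
        * (1 / ν + N * h / μ) := by
  have hNpos : (0 : ℝ) < N := by exact_mod_cast hN
  have hL : 0 < N * h := by positivity
  set L := N * h with hLdef
  set G := 2 / (c * μ * L) + 4 / √(c * μ) with hG
  have hm : 0 < c * μ := by positivity
  have hs : 0 < √(c * μ) := Real.sqrt_pos.2 hm
  have hss : √(c * μ) * √(c * μ) = c * μ := Real.mul_self_sqrt hm.le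
  have hG₀ : 0 ≤ G := by positivity
  have hbound : ∀ k ∈ Finset.range n, b k ≤
      G * (c * μ / 2 * trapezoid h N (fun i => v i k ^ 2)
        + ∑ i ∈ Finset.range N, h * dx h (fun j => v j k) i ^ 2) := by
    intro k hk
    obtain ⟨i, hi, hbi⟩ := hb k (Finset.mem_range.1 hk)
    rw [hbi]
    refine (sq_le_discrete_sobolev hh hs hN (fun j => v j k) hi).trans ?_
    set X := trapezoid h N (fun i => v i k ^ 2)
    set Y := ∑ i ∈ Finset.range N, h * dx h (fun j => v j k) i ^ 2
    have hY : 0 ≤ Y := Finset.sum_nonneg fun _ _ => by positivity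
    have e1 : G * (c * μ / 2 * X) = X / L + 2 * √(c * μ) * X := by
      have : 4 / √(c * μ) * (c * μ / 2) = 2 * √(c * μ) := by
        rw [div_mul_eq_mul_div, div_eq_iff hs.ne']; linarith
      rw [← mul_assoc, hG, add_mul, this]
      field_simp
    have e2 : 1 / (2 * √(c * μ)) * Y ≤ G * Y := by
      refine mul_le_mul_of_nonneg_right ?_ hY
      have : 0 ≤ 2 / (c * μ * L) := by positivity
      have e3 : 1 / (2 * √(c * μ)) ≤ 4 / √(c * μ) := by
        rw [div_le_div_iff₀ (by positivity) hs]; linarith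
      linarith
    rw [mul_add, e1]
    linarith
  have hGK := sobolev_factor_le hc hc₁ hL hμ
  have hR : L * R ^ 2 / (2 * (c * μ)) + R ^ 2 / (2 * (c * ν)) ≤
      R ^ 2 / c * (1 / ν + L / μ) := by
    have e : R ^ 2 / c * (1 / ν + L / μ) = 2 * (L * R ^ 2 / (2 * (c * μ)) + R ^ 2 / (2 * (c * ν)))
        := by field_simp; ring
    have : 0 ≤ L * R ^ 2 / (2 * (c * μ)) + R ^ 2 / (2 * (c * ν)) := by positivity
    linarith
  calc _ ≤ _ := Finset.sum_le_sum hbound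
    _ ≤ G * (n * (L * R ^ 2 / (2 * (c * μ)) + R ^ 2 / (2 * (c * ν)))) := by
        rw [← Finset.mul_sum]
        exact mul_le_mul_of_nonneg_left hen hG₀
    _ ≤ 4 / c * ((1 + √(1 + L ^ 2 * μ)) / (L * μ)) *
          (n * (R ^ 2 / c * (1 / ν + L / μ))) := by gcongr
    _ = _ := by ring

end FIDR

theorem mainTheorem1 (α xl xr T : ℝ) (hα₀ : 0 < α) (hα₁ : α < 1) (hx : xl < xr) (hT : 0 < T)
    (f : ℝ → ℝ → ℝ) (u₀ : ℝ → ℝ) (u : ℝ → ℝ → ℝ)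
    (hf : ∀ t ∈ Set.Ioc 0 T, ContinuousOn (fun x => f x t) (Set.Icc xl xr))
    (hu₀ : ContinuousOn u₀ (Set.Icc xl xr))
    (hu : FIDR.IsC42 xl xr T u)
    (hsol : FIDR.IsSolution α xl xr T f u₀ u) :
    ∃ c₁ : ℝ, 0 < c₁ ∧
      ∀ (NT NS : ℕ), 0 < NT → 0 < NS →
      ∀ (dt h : ℝ), dt = T / NT → h = (xr - xl) / NS →
      ∀ (ε₀ : ℝ), 0 < ε₀ →
      ∀ (N N' : ℕ) (w s : Fin N → ℝ) (w' s' : Fin N' → ℝ),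
        FIDR.IsSumOfExp α dt T ε₀ w s →
        FIDR.IsSumOfExp (α / 2) dt T ε₀ w' s' →
      ∀ U : ℕ → ℕ → ℝ, FIDR.IsSchemeSolution α xl h dt NS NT f u₀ w s w' s' U →
      ∀ n : ℕ, 1 ≤ n → n ≤ NT →
      ∀ μ ν c₂ : ℝ,
        μ = FIDR.coercivity α ε₀ (n * dt) → ν = FIDR.coercivity (α / 2) ε₀ (n * dt) →
        0 < μ → 0 < ν →
        c₂ = FIDR.errorConst c₁ T (xr - xl) μ ν →
        0 < c₂ ∧
        √(dt * ∑ k ∈ Finset.Icc 1 n, FIDR.errorNorm xl h dt NS u U k ^ 2)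
          ≤ c₂ * (dt ^ (2 - α) + h ^ 2 + ε₀) := by
  obtain ⟨ca, hca₀, hca₁, hca⟩ := FIDR.exists_fidr_coercive hα₀ hα₁
  obtain ⟨cb, hcb₀, hcb₁, hcb⟩ :=
    FIDR.exists_fidr_coercive (β := α / 2) (by linarith) (by linarith)
  obtain ⟨C, hC, hcons⟩ := FIDR.exists_consistency hα₀ hα₁ hx hT hf hu hsol
  set c := min ca cb with hcdef
  have hc₀ : 0 < c := lt_min hca₀ hcb₀
  have hc₁ : c ≤ 1 := (min_le_left _ _).trans hca₁
  refine ⟨C / c, by positivity, ?_⟩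
  intro NT NS hNT hNS dt h hdt hh ε hε N N' w s w' s' hw hw' U hU n hn hnNT μ ν c₂ hμ hν hμ₀ hν₀ hc₂
  have hL : 0 < xr - xl := by linarith
  have hNT' : (0 : ℝ) < NT := by exact_mod_cast hNT
  have hNS' : (0 : ℝ) < NS := by exact_mod_cast hNS
  have hdt₀ : 0 < dt := by rw [hdt]; positivity
  have hh₀ : 0 < h := by rw [hh]; positivity
  have hNh : NS * h = xr - xl := by rw [hh]; field_simp
  have hNdt : NT * dt = T := by rw [hdt]; field_simp
  have htime : ∀ k ≤ NT, (k : ℝ) * dt ≤ T := fun k hk => by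
    rw [← hNdt]; gcongr
  have hnT := htime n hnNT
  have hright : xl + NS * h = xr := by linarith
  have hc₂₀ : 0 < c₂ := hc₂ ▸ FIDR.errorConst_pos (by positivity) hT hL hμ₀ hν₀
  refine ⟨hc₂₀, ?_⟩
  set E := dt ^ (2 - α) + h ^ 2 + ε with hE
  have hE₀ : 0 < E := by positivity
  set e : ℕ → ℕ → ℝ := fun i k => U i k - u (xl + i * h) (k * dt) with he
  have he0 : ∀ i ≤ NS, e i 0 = 0 := fun i hi => by
    simp only [he]
    rw [hU.init i hi, Nat.cast_zero, zero_mul,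
      hsol.init_Icc hu hx hT hu₀ (FIDR.mesh_mem_Icc hNS hx hh hi), sub_self]
  have hsumsq : ∀ i, 0 ≤ ∑ k ∈ Finset.range n, e i (k + 1) ^ 2 := fun i =>
    Finset.sum_nonneg fun _ _ => sq_nonneg _
  have hA : ∀ i ≤ NS, c * μ * ∑ k ∈ Finset.range n, e i (k + 1) ^ 2 ≤
      ∑ k ∈ Finset.range n, e i (k + 1) * FIDR.fidr α dt w s (e i) (k + 1) := fun i hi => by
    refine le_trans ?_ (hca T dt ε N w s hdt₀ hε.le hw n hn hnT (hμ ▸ hμ₀) (e i) (he0 i hi))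
    rw [← hμ]
    exact mul_le_mul_of_nonneg_right
      (mul_le_mul_of_nonneg_right (min_le_left _ _) hμ₀.le) (hsumsq i)
  have hB : ∀ i ≤ NS, c * ν * ∑ k ∈ Finset.range n, e i (k + 1) ^ 2 ≤
      ∑ k ∈ Finset.range n, e i (k + 1) * FIDR.fidr (α / 2) dt w' s' (e i) (k + 1) :=
    fun i hi => by
    refine le_trans ?_ (hcb T dt ε N' w' s' hdt₀ hε.le hw' n hn hnT (hν ▸ hν₀) (e i) (he0 i hi))
    rw [← hν]
    exact mul_le_mul_of_nonneg_right
      (mul_le_mul_of_nonneg_right (min_le_right _ _) hν₀.le) (hsumsq i)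
  have hfid : ∀ (β : ℝ) {N : ℕ} (w s : Fin N → ℝ) (i k : ℕ), FIDR.fidr β dt w s (e i) k =
      FIDR.fidr β dt w s (U i) k
        - FIDR.fidr β dt w s (fun k => u (xl + i * h) (k * dt)) k :=
    fun β N w s i k => FIDR.fidr_sub β dt w s (U i) _ k
  have hdx : ∀ k i, FIDR.dx h (fun j => e j k) i = FIDR.dx h (fun j => U j k) i
      - FIDR.dx h (fun j => u (xl + j * h) (k * dt)) i := fun k i => FIDR.dx_sub h _ _ i
  have hdxx : ∀ k i, FIDR.dxx h (fun j => e j k) i = FIDR.dxx h (fun j => U j k) i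
      - FIDR.dxx h (fun j => u (xl + j * h) (k * dt)) i := fun k i => FIDR.dxx_sub h _ _ i
  have hcons' := fun k (hk : k < n) => hcons NS dt h ε hNS hdt₀ hh hε.le N N' w s w' s' hw hw'
    (k + 1) (by omega) (htime (k + 1) (by omega))
  have hen := FIDR.sum_energy_le (v := fun i k => e i (k + 1))
    (A := fun i k => FIDR.fidr α dt w s (e i) (k + 1))
    (B := fun k => FIDR.fidr (α / 2) dt w' s' (e 0) (k + 1))
    (B' := fun k => FIDR.fidr (α / 2) dt w' s' (e NS) (k + 1)) (n := n) (R := C * E)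
    hh₀ (mul_pos hc₀ hμ₀) (mul_pos hc₀ hν₀) hNS
    (fun k hk i hi hiN => by
      have h1 := (hcons' k hk).1 i hi hiN
      have h2 := hU.interior (k + 1) (by omega) (by omega) i hi hiN
      rw [hfid, hdxx, h2, ← abs_neg]
      convert h1 using 2
      ring)
    (fun k hk => by
      have h1 := (hcons' k hk).2.1
      have h2 := hU.left (k + 1) (by omega) (by omega)
      rw [hfid, hfid, hdx, h2, ← abs_neg]
      simp only [Nat.cast_zero, zero_mul, add_zero] at *
      convert h1 using 2
      field_simp
      ring)
    (fun k hk => by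
      have h1 := (hcons' k hk).2.2
      have h2 := hU.right (k + 1) (by omega) (by omega)
      rw [hfid, hfid, hdx, h2, ← abs_neg, hright]
      convert h1 using 2
      field_simp
      ring)
    hA (hB 0 (Nat.zero_le _)) (hB NS le_rfl)
  have hmax := FIDR.sum_sup_norm_sq_le (b := fun k => FIDR.errorNorm xl h dt NS u U (k + 1) ^ 2)
    hh₀ hc₀ hc₁ hμ₀ hν₀ hNS hen (fun k _ => by
      obtain ⟨i, hi, h⟩ := FIDR.exists_errorNorm_eq xl h dt NS u U (k + 1)
      exact ⟨i, hi, by simp only [h, sq_abs, he]⟩)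
  have hIcc : ∑ k ∈ Finset.Icc 1 n, FIDR.errorNorm xl h dt NS u U k ^ 2 =
      ∑ k ∈ Finset.range n, FIDR.errorNorm xl h dt NS u U (k + 1) ^ 2 := by
    rw [← Finset.Ico_add_one_right_eq_Icc, Finset.sum_Ico_eq_sum_range, Nat.add_sub_cancel]
    simp only [add_comm 1]
  rw [hIcc]
  refine Real.sqrt_le_iff.2 ⟨by positivity, ?_⟩
  rw [hNh] at hmax
  rw [mul_pow, hc₂, FIDR.errorConst, Real.sq_sqrt (by positivity)]
  set K := (1 + √(1 + (xr - xl) ^ 2 * μ)) / ((xr - xl) * μ) * (1 / ν + (xr - xl) / μ) with hK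
  have hK₀ : 0 ≤ K := by positivity
  calc _ ≤ dt * _ := mul_le_mul_of_nonneg_left hmax hdt₀.le
    _ = 4 * (C / c) ^ 2 * K * E ^ 2 * (n * dt) := by rw [hK]; ring
    _ ≤ 4 * (C / c) ^ 2 * K * E ^ 2 * T := by gcongr
    _ = _ := by rw [hK]; ring
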